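/- Let $n\ge 2$ and let $S\subset\mathbb{R}^n$ be a smooth embedded hypersurface (codimension $1$, without boundary) with a smooth unit normal field (Gauss map) $N:S\to\mathbb{S}^{n-1}$, surface measure $\mathrm{d}\sigma$ and tangent spaces $T_uS=\langle N(u)\rangle^\perp$; $P_{T_uS}$ denotes the orthogonal projection of $\mathbb{R}^n$ onto $T_uS$. Assume that $S$ is strictly convex, meaning that the shape operator $\mathrm{d}N_u$ is positive definite at every $u\in S$ and that $N$ is injective, and that $N(S)$ is geodesically convex, meaning that $N(S)$ contains no pair of antipodal points and that its intersection with every great circle is connected (possibly empty). For $u,u'\in S$ with $u'\ne u$, let $R_uu'$ be the (unique) point $u''\in S$, $u''\neq u'$, such that $$(u'-u'')\cdot N(u)=0\quad\text{and}\quad N(u)\wedge N(u')\wedge N(u'')=0,$$ whenever such a point exists; put $R_uu=u$. Let $D_u$ be the set of those $u'\in S\setminus\{u\}$ for which $R_uu'$ exists, and for $u'\in D_u$ let $J(u,u')$ be the Jacobian at $u$ of the map $u\mapsto R_uu'$, i.e. the factor by which its differential $T_uS\to T_{R_uu'}S$ scales $(n-1)$-dimensional volume, so that $\mathrm{d}\sigma(R_uu')=J(u,u')\,\mathrm{d}\sigma(u)$.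 For $g\in L^2(S)$ with compact support in $S$, set $$\widehat{g\mathrm{d}\sigma}(x)=\int_S g(u)e^{-2\pi i x\cdot u}\,\mathrm{d}\sigma(u)\qquad(x\in\mathbb{R}^n),$$ $$W_S(g,g)(u,v)=\int_{D_u} g(u')\overline{g(R_uu')}\,e^{-2\pi i v\cdot(u'-R_uu')}J(u,u')\,\mathrm{d}\sigma(u')\qquad(u\in S,\ v\in T_uS).$$ Let $X_Sw(u,v)=Xw(N(u),v)=\int_{\mathbb{R}}w(v+tN(u))\,\mathrm{d}t$ for functions $w$ on $\mathbb{R}^n$, and $X_S^*h(x)=\int_S h(u,P_{T_uS}x)\,\mathrm{d}\sigma(u)$ for functions $h$ on the tangent bundle $TS$. Then, for $\sigma$-almost every $u\in S$, the integral defining $W_S(g,g)(u,v)$ converges absolutely for all $v\in T_uS$; for every $x\in\mathbb{R}^n$ the integral defining $X_S^*W_S(g,g)(x)$ converges absolutely and $$|\widehat{g\mathrm{d}\sigma}(x)|^2=X_S^*W_S(g,g)(x).$$ Moreover, for every $w\in L^1(\mathbb{R}^n)$ (in particular for every test function $w$), $$\int_{\mathbb{R}^n}|\widehat{g\mathrm{d}\sigma}(x)|^2w(x)\,\mathrm{d}x=\int_S\int_{T_uS}W_S(g,g)(u,v)\,X_Sw(u,v)\,\mathrm{d}v\,\mathrm{d}\sigma(u),$$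 where the integrand on the left is integrable, the inner integrand on the right is integrable in $v$ for $\sigma$-almost every $u$, and the inner integral is integrable in $u$. -/

import Mathlib

open scoped ContDiff MeasureTheory ComplexConjugate

noncomputable section

namespace PhaseSpace

/-- Euclidean space of dimension `n`. -/
abbrev Euc (n : ℕ) : Type := EuclideanSpace ℝ (Fin n)

/-- A smooth embedded hypersurface of `ℝⁿ` (codimension one, without boundary), together with a
smooth unit normal field (a Gauss map). Near each of its points the hypersurface is the zero set
of a smooth function `f` whose gradient does not vanish on it, and the normal is `∇f / |∇f|`.
Only the values of `normal` on `carrier` carry information. -/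
structure Hypersurface (n : ℕ) where
  /-- the underlying set of points -/
  carrier : Set (Euc n)
  /-- the Gauss map `N` -/
  normal : Euc n → Euc n
  exists_local_equation : ∀ u ∈ carrier, ∃ (U : Set (Euc n)) (f : Euc n → ℝ),
    IsOpen U ∧ u ∈ U ∧ ContDiffOn ℝ ∞ f U ∧
    (∀ x ∈ U, x ∈ carrier ↔ f x = 0) ∧
    ∀ x ∈ U, x ∈ carrier → gradient f x ≠ 0 ∧ normal x = ‖gradient f x‖⁻¹ • gradient f x

namespace Hypersurface

variable {n : ℕ} (S : Hypersurface n)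

/-- Surface measure `dσ` on `S`: the `(n-1)`-dimensional Hausdorff measure, normalised so as to
agree with Lebesgue measure on `(n-1)`-dimensional Euclidean spaces, restricted to `S`. -/
def surfaceMeasure : MeasureTheory.Measure (Euc n) :=
  (μHE[n - 1] : MeasureTheory.Measure (Euc n)).restrict S.carrier

/-- The tangent space `T_u S = ⟨N(u)⟩^⊥`, as a linear subspace of `ℝⁿ`. -/
abbrev tangentSpace (u : Euc n) : Submodule ℝ (Euc n) := (Submodule.span ℝ {S.normal u})ᗮ

/-- The differential at `u ∈ S` of a map `F : S → ℝⁿ`, as a linear map `T_u S → ℝⁿ`.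
A derivative of `F` within `S` is determined on `T_u S`, so restricting to `T_u S` removes
the ambiguity in `fderivWithin`. -/
def surfaceDeriv (F : Euc n → Euc n) (u : Euc n) : S.tangentSpace u →L[ℝ] Euc n :=
  (fderivWithin ℝ F S.carrier u).comp (S.tangentSpace u).subtypeL

/-- The shape operator `dN_u`, here as a map from `T_u S` to `ℝⁿ`. -/
def shapeOperator (u : Euc n) : S.tangentSpace u →L[ℝ] Euc n :=
  S.surfaceDeriv S.normal u

/-- Strict convexity: the shape operator is positive definite at every point of `S`, and the
Gauss map is injective on `S`. -/
def StrictlyConvex : Prop :=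
  (∀ u ∈ S.carrier, ∀ v : S.tangentSpace u, v ≠ 0 → 0 < inner ℝ (S.shapeOperator u v) (v : Euc n)) ∧
  Set.InjOn S.normal S.carrier

/-- Geodesic convexity of the set `N(S)` of unit normals: `N(S)` contains no pair of antipodal
points, and its intersection with any great circle is connected (possibly empty). -/
def GeodesicallyConvexNormals : Prop :=
  (∀ u ∈ S.carrier, ∀ u' ∈ S.carrier, S.normal u ≠ -S.normal u') ∧
  ∀ P : Submodule ℝ (Euc n), Module.finrank ℝ P = 2 →
    IsPreconnected (S.normal '' S.carrier ∩ (P : Set (Euc n)))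

/-- The defining property of the point `u'' = R_u u'` (for `u' ≠ u`): it is a point of `S` other
than `u'` with `(u' - u'') ⬝ N(u) = 0` and `N(u) ∧ N(u') ∧ N(u'') = 0`. -/
def IsReflection (u u' u'' : Euc n) : Prop :=
  u'' ∈ S.carrier ∧ u'' ≠ u' ∧ inner ℝ (u' - u'') (S.normal u) = 0 ∧
    ¬ LinearIndependent ℝ ![S.normal u, S.normal u', S.normal u'']

/-- The set of those `u' ∈ S` for which `R_u u'` exists in `S`. -/
def reflectionDomain (u : Euc n) : Set (Euc n) :=
  {u' | u' ∈ S.carrier ∧ u' ≠ u ∧ ∃ u'', S.IsReflection u u' u''}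

open Classical in
/-- The map `(u, u') ↦ R_u u'`, with `R_u u = u`. (The value is irrelevant where `u' ≠ u` and no
such point exists.) -/
def refl (u u' : Euc n) : Euc n :=
  if h : u' ≠ u ∧ ∃ u'', S.IsReflection u u' u'' then h.2.choose else u'

/-- The Jacobian `J(u, u')` of the map `u ↦ R_u u'` (for fixed `u'`): the factor by which its
differential `T_u S → T_{R_u u'} S` scales `(n-1)`-dimensional volume, so that
`dσ(R_u u') = J(u, u') dσ(u)`. -/
def jacobian (u u' : Euc n) : ℝ :=
  (S.surfaceDeriv (fun p => S.refl p u') u).toLinearMap.normDet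

/-- The integrand of the Wigner transform, a function of `u' ∈ S`:
`g₁(u') conj(g₂(R_u u')) exp(-2πi v ⬝ (u' - R_u u')) J(u, u')`. -/
def wignerIntegrand (g₁ g₂ : Euc n → ℂ) (u : Euc n) (v : S.tangentSpace u) (u' : Euc n) : ℂ :=
  g₁ u' * conj (g₂ (S.refl u u')) *
    Complex.exp (((-2 * Real.pi * inner ℝ (v : Euc n) (u' - S.refl u u') : ℝ) : ℂ) * Complex.I) *
    (S.jacobian u u' : ℂ)

/-- The surface-carried Wigner transform `W_S(g₁, g₂)(u, v)`, for `u ∈ S` and `v ∈ T_u S`.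
The integral is over those `u' ∈ S` for which `R_u u'` exists. -/
def wigner (g₁ g₂ : Euc n → ℂ) (u : Euc n) (v : S.tangentSpace u) : ℂ :=
  ∫ u' in S.reflectionDomain u, S.wignerIntegrand g₁ g₂ u v u' ∂S.surfaceMeasure

/-- The Fourier extension operator `(g dσ)^(x) = ∫_S g(u) exp(-2πi x ⬝ u) dσ(u)`. -/
def extension (g : Euc n → ℂ) (x : Euc n) : ℂ :=
  ∫ u, g u * Complex.exp (((-2 * Real.pi * inner ℝ x u : ℝ) : ℂ) * Complex.I) ∂S.surfaceMeasure

end Hypersurface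

/-- The X-ray transform `Xw(θ, v) = ∫ w(v + tθ) dt`. -/
def xray {n : ℕ} (w : Euc n → ℂ) (θ v : Euc n) : ℂ :=
  ∫ t : ℝ, w (v + t • θ)

namespace Hypersurface

variable {n : ℕ} (S : Hypersurface n)

/-- `X_S w(u, v) = Xw(N(u), v)`: the pullback of the X-ray transform by the Gauss map. -/
def surfaceXray (w : Euc n → ℂ) (u : Euc n) (v : S.tangentSpace u) : ℂ :=
  xray w (S.normal u) (v : Euc n)

/-- `X_S^* h(x) = ∫_S h(u, P_{T_u S} x) dσ(u)` for a function `h` on the tangent bundle `TS`. -/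
def surfaceXrayAdjoint (h : (u : Euc n) → S.tangentSpace u → ℂ) (x : Euc n) : ℂ :=
  ∫ u, h u ((S.tangentSpace u).orthogonalProjectionOnto x) ∂S.surfaceMeasure

end Hypersurface

end PhaseSpace

end

open scoped ContDiff MeasureTheory ComplexConjugate

noncomputable section

namespace PhaseSpace

/-! ### The area formula for injective C¹ immersions. -/

section AreaFormula

set_option linter.unusedSectionVars false

open MeasureTheory Set Filter Topology Module
open scoped NNReal ENNReal

variable {E F : Type*} [NormedAddCommGroup E] [InnerProductSpace ℝ E] [FiniteDimensional ℝ E]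
  [NormedAddCommGroup F] [InnerProductSpace ℝ F] [FiniteDimensional ℝ F]

/-! Expanding the square, the left side is the integral of g(u') conj(g(u'')) exp(-2πi x·(u'-u''))
over pairs (u'', u') in S × S. Replace u'' by the point u with u'' = R_u u'. The Jacobian J turns
dσ(u'')dσ(u') into J dσ(u)dσ(u'), and because the chord u'-u'' is orthogonal to N(u), the phase sees
only the projection of x to T_uS. Fubini gives the pointwise identity. The dual form comes from
integrating against w and slicing ℝⁿ into lines parallel to N(u), along which the Wigner transform,
as a function of x, is constant.

The substance is that this substitution is a legitimate change of variables. The cone over N(S) is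
open, by the inverse function theorem, and convex, by geodesic convexity
(`GeodesicallyConvexNormals.convex_normalCone`). It therefore lies in an open half-space with some
unit pole e, and the directions e + z with z ⊥ e parametrize S by a convex open set (`gaussChart`)
in which great circles become straight lines. For parameters z'' ≠ z' the pairing of the chord with
the direction e + z is affine along the line through z'' and z', and has opposite signs at the two
endpoints (`inner_sub_dir_pos`, from positivity of the shape operator). Hence there is exactly one
admissible z on the line, and it lies strictly between z'' and z': this is `mid`.

The map (z'', z') ↦ (mid, z') is injective (`injOn_midPair`) with injective differential
(`injective_fderiv_midPair`), so it is a diffeomorphism onto an open set, and its inverse is the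
reflection (`isReflection_iff`, `refl_map`). `jacobian_map` expresses J through its determinant and
the density of surface measure in the chart, which the area formula supplies. `map_reflPoint` is the
resulting identity of measures on S × S, the diagonal being null. -/

theorem continuous_normDet : Continuous fun L : E →L[ℝ] F => L.toLinearMap.normDet := by
  have h : (fun L : E →L[ℝ] F => L.toLinearMap.normDet) =
      fun L : E →L[ℝ] F => √((ContinuousLinearMap.adjoint L ∘SL L).det) := by
    ext L
    have h := L.normDet_sq
    simp only [RCLike.ofReal_real_eq_id, id] at h
    rw [← h, Real.sqrt_sq (LinearMap.normDet_nonneg _)]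
  rw [h]
  refine Real.continuous_sqrt.comp (ContinuousLinearMap.continuous_det.comp ?_)
  have h1 : Continuous fun L : E →L[ℝ] F => ContinuousLinearMap.adjoint L :=
    ContinuousLinearMap.adjoint.continuous
  exact h1.clm_comp continuous_id

theorem normDet_pos_of_injective {L : E →ₗ[ℝ] F} (hL : Function.Injective L) : 0 < L.normDet := by
  refine lt_of_le_of_ne (LinearMap.normDet_nonneg _) (Ne.symm ?_)
  rw [Ne, LinearMap.normDet_eq_zero_iff_ker_ne_bot, not_not]
  exact LinearMap.ker_eq_bot.2 hL

variable [MeasurableSpace E] [BorelSpace E] [MeasurableSpace F] [BorelSpace F]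

/-- Hausdorff measures of two images of a set compare if the distances in the images do. -/
theorem euclideanHausdorffMeasure_image_le_of_dist_le {X : Type*} [Nonempty X] (d : ℕ)
    {f g : X → F} {A : Set X} {k : ℝ≥0}
    (h : ∀ x ∈ A, ∀ y ∈ A, dist (f x) (f y) ≤ k * dist (g x) (g y)) :
    (μHE[d] : Measure F) (f '' A) ≤ (k : ℝ≥0∞) ^ d * (μHE[d] : Measure F) (g '' A) := by
  have hmem : ∀ x ∈ A, Function.invFunOn g A (g x) ∈ A := fun x hx =>
    Function.invFunOn_mem ⟨x, hx, rfl⟩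
  have heq : ∀ x ∈ A, g (Function.invFunOn g A (g x)) = g x := fun x hx =>
    Function.invFunOn_eq ⟨x, hx, rfl⟩
  -- The hypothesis makes f factor through g on A, by a k-Lipschitz map on the image of g. Neither f
  -- nor g need be injective.
  have hLip : LipschitzOnWith k (f ∘ Function.invFunOn g A) (g '' A) := by
    refine LipschitzOnWith.of_dist_le_mul ?_
    rintro _ ⟨x, hx, rfl⟩ _ ⟨y, hy, rfl⟩
    have := h _ (hmem x hx) _ (hmem y hy)
    rwa [heq x hx, heq y hy] at this
  have himg : (f ∘ Function.invFunOn g A) '' (g '' A) = f '' A := by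
    rw [image_image]
    refine image_congr fun x hx => ?_
    have := h _ (hmem x hx) _ hx
    rw [heq x hx, dist_self, mul_zero] at this
    exact dist_le_zero.1 this
  have := hLip.hausdorffMeasure_image_le (d := d) (by positivity)
  rw [himg, ENNReal.rpow_natCast] at this
  simp only [Measure.euclideanHausdorffMeasure_def, Measure.smul_apply, ENNReal.smul_def,
    smul_eq_mul]
  calc _ ≤ _ := mul_le_mul_right this _
    _ = _ := by ring

/-- An injective L is bounded below, so the linearization error is a small fraction of ‖L (x - y)‖,
and f distorts distances like L up to a factor close to 1. -/
theorem exists_nhds_dist_le_of_hasStrictFDerivAt {f : E → F} {L : E →L[ℝ] F} {x₀ : E}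
    (hf : HasStrictFDerivAt f L x₀) (hL : Function.Injective L) {k : ℝ} (hk : 1 < k) :
    ∃ U ∈ 𝓝 x₀, ∀ x ∈ U, ∀ y ∈ U, dist (f x) (f y) ≤ k * dist (L x) (L y) ∧
      dist (L x) (L y) ≤ k * dist (f x) (f y) := by
  obtain ⟨M, hM0, hM⟩ := (L : E →ₗ[ℝ] F).exists_antilipschitzWith (LinearMap.ker_eq_bot.2 hL)
  have hk0 : 0 < k := by linarith
  -- This constant makes the error at most (k - 1)/k times ‖L (x - y)‖; both bounds follow, as 1 -
  -- (k - 1)/k = 1/k and 1 + (k - 1)/k ≤ k.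
  have hc : 0 < (k - 1) / (k * M) := div_pos (by linarith) (mul_pos hk0 (by exact_mod_cast hM0))
  obtain ⟨U, hU, hUf⟩ := hf.approximates_deriv_on_nhds (c := ⟨_, hc.le⟩) (Or.inr hc)
  refine ⟨U, hU, fun x hx y hy => ?_⟩
  have h1 := hUf x hx y hy
  have h2 : ‖x - y‖ ≤ M * ‖L x - L y‖ := by
    have := hM.le_mul_dist x y
    simpa [dist_eq_norm] using this
  have h3 : ‖f x - f y - L (x - y)‖ ≤ (k - 1) / k * ‖L x - L y‖ := by
    calc _ ≤ (k - 1) / (k * M) * ‖x - y‖ := h1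
      _ ≤ (k - 1) / (k * M) * (M * ‖L x - L y‖) := by gcongr
      _ = _ := by
        have : (M : ℝ) ≠ 0 := by exact_mod_cast hM0.ne'
        field_simp
  rw [map_sub] at h3
  have h4 : ‖f x - f y‖ ≤ ‖L x - L y‖ + (k - 1) / k * ‖L x - L y‖ := by
    have := norm_add_le (L x - L y) (f x - f y - (L x - L y))
    rw [add_sub_cancel] at this
    linarith
  have h5 : ‖L x - L y‖ ≤ ‖f x - f y‖ + (k - 1) / k * ‖L x - L y‖ := by
    have := norm_sub_le (f x - f y) (f x - f y - (L x - L y))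
    rw [sub_sub_cancel] at this
    linarith
  rw [dist_eq_norm, dist_eq_norm]
  have hkk : (k - 1) / k = 1 - 1 / k := by field_simp
  constructor
  · have : (k - 1) / k ≤ k - 1 := div_le_self (by linarith) hk.le
    nlinarith [norm_nonneg (L x - L y)]
  · rw [hkk] at h5
    have : 1 / k * ‖L x - L y‖ ≤ ‖f x - f y‖ := by linarith
    calc ‖L x - L y‖ = k * (1 / k * ‖L x - L y‖) := by field_simp
      _ ≤ _ := by gcongr

theorem volume_linear_image (L : E →L[ℝ] F) (A : Set E) :
    (μHE[finrank ℝ E] : Measure F) (L '' A) =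
      ENNReal.ofReal L.toLinearMap.normDet * volume A :=
  LinearMap.euclideanHausdorffMeasure_image_eq_normDet_mul_volume L.toLinearMap A

/-- Local area formula with multiplicative error. Comparing f with its linearization at x₀ costs one
factor k per dimension; freezing the density at x₀ costs one more, hence the exponent. -/
theorem exists_nhds_area_le {f : E → F} {f' : E → E →L[ℝ] F} {K : Set E} (hK : IsOpen K)
    (hf : ∀ x ∈ K, HasStrictFDerivAt f (f' x) x) (hf'c : ContinuousOn f' K)
    (hf'i : ∀ x ∈ K, Function.Injective (f' x)) {k : ℝ≥0} (hk : 1 < k) {x₀ : E} (hx₀ : x₀ ∈ K) :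
    ∃ U : Set E, IsOpen U ∧ x₀ ∈ U ∧ ∀ A : Set E, MeasurableSet A → A ⊆ U → A ⊆ K →
      (μHE[finrank ℝ E] : Measure F) (f '' A) ≤ (k : ℝ≥0∞) ^ (finrank ℝ E + 1) *
        ∫⁻ x in A, ENNReal.ofReal (f' x).toLinearMap.normDet ∧
      ∫⁻ x in A, ENNReal.ofReal (f' x).toLinearMap.normDet ≤ (k : ℝ≥0∞) ^ (finrank ℝ E + 1) *
        (μHE[finrank ℝ E] : Measure F) (f '' A) := by
  have hk' : (1 : ℝ) < k := by exact_mod_cast hk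
  obtain ⟨V, hV, hVd⟩ := exists_nhds_dist_le_of_hasStrictFDerivAt (hf x₀ hx₀) (hf'i x₀ hx₀) hk'
  set ρ : E → ℝ := fun x => (f' x).toLinearMap.normDet with hρ
  have hρpos : 0 < ρ x₀ := normDet_pos_of_injective (hf'i x₀ hx₀)
  have hρc : ContinuousAt ρ x₀ :=
    (continuous_normDet.continuousAt).comp (hf'c.continuousAt (hK.mem_nhds hx₀))
  have h1 : ∀ᶠ x in 𝓝 x₀, ρ x < k * ρ x₀ :=
    hρc.eventually_lt continuousAt_const (by nlinarith)
  have h2 : ∀ᶠ x in 𝓝 x₀, ρ x₀ < k * ρ x :=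
    continuousAt_const.eventually_lt (continuousAt_const.mul hρc) (by nlinarith)
  obtain ⟨U, hUs, hUo, hxU⟩ := mem_nhds_iff.1 (Filter.inter_mem hV (h1.and h2))
  refine ⟨U, hUo, hxU, fun A hAm hAU hAK => ?_⟩
  have hL := volume_linear_image (f' x₀) A
  have hVA : ∀ x ∈ A, ∀ y ∈ A, _ := fun x hx y hy => hVd x (hUs (hAU hx)).1 y (hUs (hAU hy)).1
  have hm1 := euclideanHausdorffMeasure_image_le_of_dist_le (finrank ℝ E) (k := k)
    (fun x hx y hy => (hVA x hx y hy).1)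
  have hm2 := euclideanHausdorffMeasure_image_le_of_dist_le (finrank ℝ E) (k := k)
    (fun x hx y hy => (hVA x hx y hy).2)
  rw [hL] at hm1 hm2
  have hi1 : ENNReal.ofReal (ρ x₀) * volume A ≤ k * ∫⁻ x in A, ENNReal.ofReal (ρ x) := by
    rw [← setLIntegral_const, ← lintegral_const_mul' _ _ ENNReal.coe_ne_top]
    refine setLIntegral_mono' hAm fun x hx => ?_
    rw [← ENNReal.ofReal_coe_nnreal, ← ENNReal.ofReal_mul (by positivity)]
    exact ENNReal.ofReal_le_ofReal (hUs (hAU hx)).2.2.le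
  have hi2 : ∫⁻ x in A, ENNReal.ofReal (ρ x) ≤ k * (ENNReal.ofReal (ρ x₀) * volume A) := by
    rw [← setLIntegral_const, ← lintegral_const_mul' _ _ ENNReal.coe_ne_top]
    refine setLIntegral_mono' hAm fun x hx => ?_
    rw [← ENNReal.ofReal_coe_nnreal, ← ENNReal.ofReal_mul (by positivity)]
    exact ENNReal.ofReal_le_ofReal (hUs (hAU hx)).2.1.le
  constructor
  · calc _ ≤ _ := hm1
      _ ≤ (k : ℝ≥0∞) ^ finrank ℝ E * (k * ∫⁻ x in A, ENNReal.ofReal (ρ x)) := by gcongr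
      _ = _ := by rw [pow_succ, mul_assoc]
  · calc _ ≤ _ := hi2
      _ ≤ k * ((k : ℝ≥0∞) ^ finrank ℝ E * (μHE[finrank ℝ E] : Measure F) (f '' A)) := by
        gcongr
      _ = _ := by rw [pow_succ', mul_assoc]

/-- The area formula for injective `C¹` immersions. -/
theorem euclideanHausdorffMeasure_image_eq_lintegral {f : E → F} {f' : E → E →L[ℝ] F} {K : Set E}
    (hK : IsOpen K) (hf : ∀ x ∈ K, HasStrictFDerivAt f (f' x) x) (hf'c : ContinuousOn f' K)
    (hf'i : ∀ x ∈ K, Function.Injective (f' x)) (hfi : InjOn f K) {A : Set E}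
    (hA : MeasurableSet A) (hAK : A ⊆ K) :
    (μHE[finrank ℝ E] : Measure F) (f '' A) =
      ∫⁻ x in A, ENNReal.ofReal (f' x).toLinearMap.normDet := by
  set ρ : E → ℝ≥0∞ := fun x => ENNReal.ofReal (f' x).toLinearMap.normDet with hρ
  have hfc : ContinuousOn f K := fun x hx => (hf x hx).continuousAt.continuousWithinAt
  have key : ∀ k : ℝ≥0, 1 < k →
      (μHE[finrank ℝ E] : Measure F) (f '' A) ≤
        (k : ℝ≥0∞) ^ (finrank ℝ E + 1) * ∫⁻ x in A, ρ x ∧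
      ∫⁻ x in A, ρ x ≤
        (k : ℝ≥0∞) ^ (finrank ℝ E + 1) * (μHE[finrank ℝ E] : Measure F) (f '' A) := by
    intro k hk
    choose! U hUo hxU hU using fun x₀ (hx₀ : x₀ ∈ K) =>
      exists_nhds_area_le hK hf hf'c hf'i hk hx₀
    obtain ⟨t, htK, htc, ht⟩ := TopologicalSpace.countable_cover_nhdsWithin
      (fun x hx => mem_nhdsWithin_of_mem_nhds ((hUo x hx).mem_nhds (hxU x hx)))
    rcases t.eq_empty_or_nonempty with rfl | htn
    · have : A = ∅ := by
        have := hAK.trans ht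
        simpa using this
      simp [this]
    obtain ⟨s, hs⟩ := htc.exists_eq_range htn
    have hsK : ∀ n, s n ∈ K := fun n => htK (hs ▸ mem_range_self n)
    -- A countable cover by the good neighbourhoods is made disjoint. Injectivity of f keeps the
    -- images disjoint, so both sides are sums over the pieces.
    set B : ℕ → Set E := fun n => A ∩ disjointed (fun n => U (s n)) n with hB
    have hBm : ∀ n, MeasurableSet (B n) := fun n =>
      hA.inter (MeasurableSet.disjointed (fun n => (hUo _ (hsK n)).measurableSet) n)
    have hBK : ∀ n, B n ⊆ K := fun n => inter_subset_left.trans hAK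
    have hBd : Pairwise (Function.onFun Disjoint B) := fun i j hij =>
      (disjoint_disjointed (fun n => U (s n)) hij).mono inter_subset_right inter_subset_right
    have hBA : ⋃ n, B n = A := by
      rw [← inter_iUnion, iUnion_disjointed, inter_eq_left]
      intro x hx
      have := ht (hAK hx)
      rw [hs, biUnion_range] at this
      exact this
    have hBU : ∀ n, B n ⊆ U (s n) := fun n => inter_subset_right.trans (disjointed_le _ n)
    have e1 : (μHE[finrank ℝ E] : Measure F) (f '' A) =
        ∑' n, (μHE[finrank ℝ E] : Measure F) (f '' B n) := by
      rw [← hBA, image_iUnion, measure_iUnion]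
      · intro i j hij
        rw [Function.onFun, disjoint_iff_inter_eq_empty, ← hfi.image_inter (hBK i) (hBK j),
          disjoint_iff_inter_eq_empty.1 (hBd hij), image_empty]
      · exact fun n => (hBm n).image_of_continuousOn_injOn (hfc.mono (hBK n)) (hfi.mono (hBK n))
    have e2 : ∫⁻ x in A, ρ x = ∑' n, ∫⁻ x in B n, ρ x := by
      rw [← hBA, lintegral_iUnion hBm hBd]
    rw [e1, e2, ← ENNReal.tsum_mul_left, ← ENNReal.tsum_mul_left]
    exact ⟨ENNReal.tsum_le_tsum fun n => (hU _ (hsK n) (B n) (hBm n) (hBU n) (hBK n)).1,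
      ENNReal.tsum_le_tsum fun n => (hU _ (hsK n) (B n) (hBm n) (hBU n) (hBK n)).2⟩
  -- Letting k decrease to 1 removes the error factor; an infinite b is treated apart.
  have lim : ∀ {a b : ℝ≥0∞}, (∀ k : ℝ≥0, 1 < k → a ≤ (k : ℝ≥0∞) ^ (finrank ℝ E + 1) * b) →
      a ≤ b := by
    intro a b h
    rcases eq_or_ne b ∞ with rfl | hb
    · exact le_top
    have ht : Tendsto (fun k : ℝ≥0 => (k : ℝ≥0∞) ^ (finrank ℝ E + 1) * b) (𝓝[>] 1) (𝓝 b) := by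
      have h1 : Tendsto (fun k : ℝ≥0 => ((k ^ (finrank ℝ E + 1) : ℝ≥0) : ℝ≥0∞)) (𝓝[>] 1)
          (𝓝 ((1 ^ (finrank ℝ E + 1) : ℝ≥0) : ℝ≥0∞)) :=
        ENNReal.tendsto_coe.2 (((continuous_pow _).tendsto _).mono_left nhdsWithin_le_nhds)
      have h2 := ENNReal.Tendsto.mul_const h1 (Or.inr hb)
      simpa using h2
    exact ge_of_tendsto ht (eventually_nhdsWithin_of_forall fun k hk => h k hk)
  exact le_antisymm (lim fun k hk => (key k hk).1) (lim fun k hk => (key k hk).2)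

theorem euclideanHausdorffMeasure_restrict_image {f : E → F} {f' : E → E →L[ℝ] F} {K : Set E}
    (hK : IsOpen K) (hf : ∀ x ∈ K, HasStrictFDerivAt f (f' x) x) (hf'c : ContinuousOn f' K)
    (hf'i : ∀ x ∈ K, Function.Injective (f' x)) (hfi : InjOn f K) :
    (μHE[finrank ℝ E] : Measure F).restrict (f '' K) =
      ((volume.restrict K).withDensity
        fun x => ENNReal.ofReal (f' x).toLinearMap.normDet).map f := by
  have hfc : ContinuousOn f K := fun x hx => (hf x hx).continuousAt.continuousWithinAt
  have hfm : AEMeasurable f ((volume.restrict K).withDensity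
      fun x => ENNReal.ofReal (f' x).toLinearMap.normDet) :=
    (hfc.aemeasurable hK.measurableSet).mono_ac (withDensity_absolutelyContinuous _ _)
  ext s hs
  have hm : MeasurableSet (K ∩ f ⁻¹' s) := by
    obtain ⟨u, hu, hu'⟩ := (continuousOn_iff_continuous_domRestrict.1 hfc).measurable hs
    have : K ∩ f ⁻¹' s = K ∩ u := by
      ext x
      refine and_congr_right fun hx => ?_
      have := Set.ext_iff.1 hu' ⟨x, hx⟩
      simpa using this.symm
    rw [this]
    exact hK.measurableSet.inter hu
  rw [Measure.restrict_apply hs, Measure.map_apply_of_aemeasurable hfm hs, inter_comm,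
    ← image_inter_preimage, euclideanHausdorffMeasure_image_eq_lintegral hK hf hf'c hf'i hfi hm
      inter_subset_left, withDensity_apply₀ _ ?_, Measure.restrict_restrict₀ ?_, inter_comm]
  all_goals
    refine hm.nullMeasurableSet.congr ?_
    filter_upwards [ae_restrict_mem hK.measurableSet] with x hx
    exact propext ⟨fun h => h.2, fun h => ⟨hx, h⟩⟩

end AreaFormula

/-! ### The Gauss map, its shape operator and its smooth inverse. -/

namespace Hypersurface

open Set Filter Topology

variable {n : ℕ} (S : Hypersurface n)

/-- Near each of its points, a hypersurface has a defining function and a smooth extension of the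
Gauss map to a field of unit vectors. -/
theorem exists_smooth_extension {u : Euc n} (hu : u ∈ S.carrier) :
    ∃ (U : Set (Euc n)) (f : Euc n → ℝ) (N : Euc n → Euc n), IsOpen U ∧ u ∈ U ∧
      ContDiffOn ℝ ∞ f U ∧ ContDiffOn ℝ ∞ N U ∧ (∀ x ∈ U, ‖N x‖ = 1) ∧
      (∀ x ∈ U, x ∈ S.carrier ↔ f x = 0) ∧ (∀ x ∈ U, x ∈ S.carrier → S.normal x = N x) ∧
      ∃ c : ℝ, 0 < c ∧ fderiv ℝ f u = c • innerSL ℝ (N u) := by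
  obtain ⟨U, f, hU, huU, hf, hfS, hN⟩ := S.exists_local_equation u hu
  have hg : ContDiffOn ℝ ∞ (gradient f) U := by
    have h1 : ContDiffOn ℝ ∞ (fderiv ℝ f) U := hf.fderiv_of_isOpen hU (by simp)
    exact (InnerProductSpace.toDual ℝ (Euc n)).symm.contDiff.comp_contDiffOn h1
  have hU' : IsOpen (U ∩ gradient f ⁻¹' {0}ᶜ) := hg.continuousOn.isOpen_inter_preimage hU
    isOpen_compl_singleton
  refine ⟨U ∩ gradient f ⁻¹' {0}ᶜ, f, fun x => ‖gradient f x‖⁻¹ • gradient f x, hU',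
    ⟨huU, (hN u huU hu).1⟩, hf.mono inter_subset_left, ?_, ?_, fun x hx => hfS x hx.1,
    fun x hx hxS => (hN x hx.1 hxS).2, ‖gradient f u‖, norm_pos_iff.2 (hN u huU hu).1, ?_⟩
  · have hg' := hg.mono (inter_subset_left (t := gradient f ⁻¹' {0}ᶜ))
    exact ((hg'.norm ℝ fun x hx => hx.2).inv fun x hx => norm_ne_zero_iff.2 hx.2).smul hg'
  · intro x hx
    rw [norm_smul, norm_inv, norm_norm, inv_mul_cancel₀ (norm_ne_zero_iff.2 hx.2)]
  · ext v
    have h0 := norm_ne_zero_iff.2 (hN u huU hu).1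
    simp only [smul_apply, innerSL_apply_apply, inner_smul_left]
    rw [gradient, InnerProductSpace.toDual_symm_apply]
    rw [gradient] at h0
    simp only [smul_eq_mul, map_inv₀, conj_trivial]
    rw [← mul_assoc, mul_inv_cancel₀ h0, one_mul]

variable {S}

theorem norm_normal {u : Euc n} (hu : u ∈ S.carrier) : ‖S.normal u‖ = 1 := by
  obtain ⟨U, f, N, -, huU, -, -, h1, -, h2, -⟩ := S.exists_smooth_extension hu
  rw [h2 u huU hu, h1 u huU]

theorem mem_tangentSpace_iff {u v : Euc n} : v ∈ S.tangentSpace u ↔ inner ℝ (S.normal u) v = 0 :=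
  Submodule.mem_orthogonal_singleton_iff_inner_right

/-- A smooth extension of the Gauss map computes the shape operator. -/
theorem shapeOperator_apply {u : Euc n} (hu : u ∈ S.carrier) {U : Set (Euc n)} {f : Euc n → ℝ}
    {N : Euc n → Euc n} (hU : IsOpen U) (huU : u ∈ U) (hf : ContDiffOn ℝ ∞ f U)
    (hN : DifferentiableAt ℝ N u) (hfS : ∀ x ∈ U, x ∈ S.carrier ↔ f x = 0)
    (hNS : ∀ x ∈ U, x ∈ S.carrier → S.normal x = N x) {c : ℝ} (hc : 0 < c)
    (hfu : fderiv ℝ f u = c • innerSL ℝ (N u)) (v : S.tangentSpace u) :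
    S.shapeOperator u v = fderiv ℝ N u v := by
  have hfs : HasStrictFDerivAt f (fderiv ℝ f u) u :=
    (hf.contDiffAt (hU.mem_nhds huU)).hasStrictFDerivAt (by simp)
  have hnorm : ‖N u‖ = 1 := by rw [← hNS u huU hu, norm_normal hu]
  have hsurj : (fderiv ℝ f u : Euc n →ₗ[ℝ] ℝ).range = ⊤ := by
    rw [LinearMap.range_eq_top]
    intro t
    refine ⟨(t / c) • N u, ?_⟩
    rw [hfu]
    simp only [ContinuousLinearMap.coe_coe, smul_apply, innerSL_apply_apply,
      inner_smul_right, real_inner_self_eq_norm_sq, hnorm, smul_eq_mul]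
    field_simp
  -- The implicit function γ parametrizes S near u by the kernel of df, which is T_uS. Both
  -- candidate derivatives of the normal, composed with the derivative of γ, differentiate the same
  -- map, so they agree on T_uS.
  have hfu0 : f u = 0 := (hfS u huU).1 hu
  have hγ := (hfs.to_implicitFunction hsurj).hasFDerivAt
  have hγm := hfs.map_implicitFunction_eq hsurj
  have hγ0 : HasStrictFDerivAt.implicitFunction f (fderiv ℝ f u) hfs hsurj (f u) 0 = u :=
    hfs.implicitFunction_apply_image hsurj
  set γ := HasStrictFDerivAt.implicitFunction f (fderiv ℝ f u) hfs hsurj (f u) with hγdef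
  have hγS : ∀ᶠ w in 𝓝 0, γ w ∈ S.carrier ∩ U := by
    have h1 : ∀ᶠ w in 𝓝 0, f (γ w) = f u :=
      (Continuous.tendsto (f := fun w => (f u, w)) (by fun_prop) 0).eventually hγm
    have h2 : ∀ᶠ w in 𝓝 0, γ w ∈ U :=
      hγ.continuousAt.eventually (by rw [hγ0]; exact hU.mem_nhds huU)
    filter_upwards [h1, h2] with w hw1 hw2
    exact ⟨(hfS _ hw2).2 (hw1.trans hfu0), hw2⟩
  have hND : DifferentiableWithinAt ℝ S.normal S.carrier u := by
    refine (hN.differentiableWithinAt (s := S.carrier)).congr_of_eventuallyEq ?_ (hNS u huU hu)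
    filter_upwards [self_mem_nhdsWithin, mem_nhdsWithin_of_mem_nhds (hU.mem_nhds huU)] with x h1 h2
    exact hNS x h2 h1
  have hNγ1 : HasFDerivAt (S.normal ∘ γ) ((fderivWithin ℝ S.normal S.carrier u).comp
      (fderiv ℝ f u : Euc n →ₗ[ℝ] ℝ).ker.subtypeL) 0 := by
    exact hND.hasFDerivWithinAt.comp_hasFDerivAt_of_eq 0 hγ (hγS.mono fun w hw => hw.1) hγ0.symm
  have hNγ2 : HasFDerivAt (S.normal ∘ γ) ((fderiv ℝ N u).comp
      (fderiv ℝ f u : Euc n →ₗ[ℝ] ℝ).ker.subtypeL) 0 := by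
    have h := hN.hasFDerivAt
    rw [← hγ0] at h
    have h2 := h.comp 0 hγ
    rw [hγ0] at h2
    refine h2.congr_of_eventuallyEq ?_
    filter_upwards [hγS] with w hw
    exact hNS _ hw.2 hw.1
  have hv : (v : Euc n) ∈ (fderiv ℝ f u : Euc n →ₗ[ℝ] ℝ).ker := by
    have := mem_tangentSpace_iff.1 v.2
    rw [hNS u huU hu] at this
    rw [LinearMap.mem_ker, hfu]
    simp [this]
  have := DFunLike.congr_fun (hNγ1.unique hNγ2) ⟨v, hv⟩
  exact this

/-- The Gauss map of a strictly convex hypersurface has smooth local inverses. -/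
theorem StrictlyConvex.exists_local_inverse (hS : S.StrictlyConvex) {u : Euc n}
    (hu : u ∈ S.carrier) :
    ∃ G : Euc n → Euc n, ContDiffAt ℝ ∞ G (S.normal u) ∧ G (S.normal u) = u ∧
      ∀ᶠ y in 𝓝 (S.normal u), ‖y‖ = 1 → G y ∈ S.carrier ∧ S.normal (G y) = y := by
  obtain ⟨U, f, N, hU, huU, hf, hN, hN1, hfS, hNS, c, hc, hfu⟩ := S.exists_smooth_extension hu
  have hfu0 : f u = 0 := (hfS u huU).1 hu
  have hfA : ContDiffAt ℝ ∞ f u := hf.contDiffAt (hU.mem_nhds huU)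
  have hNA : ContDiffAt ℝ ∞ N u := hN.contDiffAt (hU.mem_nhds huU)
  have hND : DifferentiableAt ℝ N u := hNA.differentiableAt (by simp)
  have hfD : DifferentiableAt ℝ f u := hfA.differentiableAt (by simp)
  -- The defining function serves as a radial coordinate, turning the Gauss map into a map between
  -- open subsets of ℝⁿ. Its differential at u is dN + df ⊗ N: since dN takes values orthogonal to
  -- N, a kernel vector is tangent and killed by dN, hence zero by positivity.
  set H : Euc n → Euc n := fun x => (1 + f x) • N x with hH
  have hHA : ContDiffAt ℝ ∞ H u := (contDiffAt_const.add hfA).smul hNA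
  have hHu : H u = S.normal u := by simp [hH, hfu0, hNS u huU hu]
  set H' : Euc n →L[ℝ] Euc n := fderiv ℝ N u + (fderiv ℝ f u).smulRight (N u) with hH'
  have hHD : HasFDerivAt H H' u := by
    have := (hfD.hasFDerivAt.const_add 1).smul hND.hasFDerivAt
    convert! this using 1
    simp [hH', hfu0]
  have hNorth : ∀ ξ, inner ℝ (N u) (fderiv ℝ N u ξ) = 0 := by
    intro ξ
    have h1 : HasFDerivAt (fun x => inner ℝ (N x) (N x)) _ u :=
      hND.hasFDerivAt.inner ℝ hND.hasFDerivAt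
    have h2 : HasFDerivAt (fun x => inner ℝ (N x) (N x)) (0 : Euc n →L[ℝ] ℝ) u := by
      refine (hasFDerivAt_const (1 : ℝ) u).congr_of_eventuallyEq ?_
      filter_upwards [hU.mem_nhds huU] with x hx
      rw [real_inner_self_eq_norm_sq, hN1 x hx, one_pow]
    have h3 := DFunLike.congr_fun (h1.unique h2) ξ
    simp only [ContinuousLinearMap.comp_apply, ContinuousLinearMap.prod_apply,
      fderivInnerCLM_apply, zero_apply] at h3
    rw [real_inner_comm (N u) (fderiv ℝ N u ξ)] at h3
    linarith
  have hinj : Function.Injective H' := by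
    rw [injective_iff_map_eq_zero]
    intro ξ hξ
    have h1 : fderiv ℝ N u ξ + (fderiv ℝ f u ξ) • N u = 0 := by simpa [hH'] using hξ
    have h2 : fderiv ℝ f u ξ = 0 := by
      have := congrArg (inner ℝ (N u)) h1
      rw [inner_add_right, hNorth, inner_smul_right, real_inner_self_eq_norm_sq, hN1 u huU] at this
      simpa using this
    have h3 : fderiv ℝ N u ξ = 0 := by simpa [h2] using h1
    have h4 : inner ℝ (N u) ξ = 0 := by
      rw [hfu] at h2
      simpa [hc.ne'] using h2
    have h5 : ξ ∈ S.tangentSpace u := by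
      rw [mem_tangentSpace_iff, hNS u huU hu, h4]
    by_contra hne
    have h6 := hS.1 u hu ⟨ξ, h5⟩ (by simpa using hne)
    rw [shapeOperator_apply hu hU huU hf hND hfS hNS hc hfu, h3] at h6
    simp at h6
  set H'' : Euc n ≃L[ℝ] Euc n :=
    (LinearEquiv.ofInjectiveEndo (H' : Euc n →ₗ[ℝ] Euc n) hinj).toContinuousLinearEquiv with hH''
  have hHD' : HasFDerivAt H (H'' : Euc n →L[ℝ] Euc n) u := by
    convert! hHD using 1
  have hHs : HasStrictFDerivAt H (H'' : Euc n →L[ℝ] Euc n) u :=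
    hHA.hasStrictFDerivAt' hHD' (by simp)
  refine ⟨hHs.localInverse H H'' u, ?_, ?_, ?_⟩
  · rw [← hHu]
    exact hHA.to_localInverse hHD' (by simp)
  · rw [← hHu]
    exact hHs.localInverse_apply_image
  · rw [← hHu]
    have hG : Tendsto (hHs.localInverse H H'' u) (𝓝 (H u)) (𝓝 u) := by
      have := hHs.localInverse_continuousAt
      rwa [ContinuousAt, hHs.localInverse_apply_image] at this
    -- For ‖y‖ = 1 the equation H x = y forces |1 + f x| = 1. Excluding f x = -2 leaves f x = 0,
    -- that is, x ∈ S.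
    have hf1 : ∀ᶠ x in 𝓝 u, -1 < f x :=
      continuousAt_const.eventually_lt hfA.continuousAt (by simp [hfu0])
    filter_upwards [hHs.eventually_right_inverse, hG.eventually hf1,
      hG.eventually (hU.mem_nhds huU)] with y h1 h2 h3 hy
    set x := hHs.localInverse H H'' u y
    have h4 : |1 + f x| = 1 := by
      have := congrArg norm h1
      rwa [norm_smul, hN1 x h3, hy, mul_one, Real.norm_eq_abs] at this
    rw [abs_of_pos (by linarith)] at h4
    have h5 : f x = 0 := by linarith
    have hx := (hfS x h3).2 h5
    refine ⟨hx, ?_⟩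
    rw [hNS x h3 hx, ← h1]
    simp [hH, h5]

variable (S) in
/-- The open cone over the set of unit normals. -/
def normalCone : Set (Euc n) := {y | y ≠ 0 ∧ ‖y‖⁻¹ • y ∈ S.normal '' S.carrier}

variable (S) in
/-- The inverse of the Gauss map, extended to be homogeneous of degree zero. -/
def gaussInv (y : Euc n) : Euc n := Function.invFunOn S.normal S.carrier (‖y‖⁻¹ • y)

theorem gaussInv_mem {y : Euc n} (hy : y ∈ S.normalCone) : S.gaussInv y ∈ S.carrier :=
  Function.invFunOn_mem hy.2

theorem normal_gaussInv {y : Euc n} (hy : y ∈ S.normalCone) :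
    S.normal (S.gaussInv y) = ‖y‖⁻¹ • y :=
  Function.invFunOn_eq hy.2

theorem gaussInv_smul {t : ℝ} (ht : 0 < t) (y : Euc n) : S.gaussInv (t • y) = S.gaussInv y := by
  rw [gaussInv, gaussInv, norm_smul, Real.norm_of_nonneg ht.le, smul_smul, mul_inv,
    mul_right_comm, inv_mul_cancel₀ ht.ne', one_mul]

theorem smul_mem_normalCone {t : ℝ} (ht : 0 < t) {y : Euc n} (hy : y ∈ S.normalCone) :
    t • y ∈ S.normalCone := by
  refine ⟨smul_ne_zero ht.ne' hy.1, ?_⟩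
  rw [norm_smul, Real.norm_of_nonneg ht.le, smul_smul, mul_inv,
    mul_right_comm, inv_mul_cancel₀ ht.ne', one_mul]
  exact hy.2

theorem normal_mem_normalCone {u : Euc n} (hu : u ∈ S.carrier) : S.normal u ∈ S.normalCone := by
  have := norm_normal hu
  refine ⟨norm_ne_zero_iff.1 (by simp [this]), ?_⟩
  rw [this, inv_one, one_smul]
  exact mem_image_of_mem _ hu

theorem StrictlyConvex.gaussInv_normal (hS : S.StrictlyConvex) {u : Euc n} (hu : u ∈ S.carrier) :
    S.gaussInv (S.normal u) = u := by
  refine hS.2 (gaussInv_mem (normal_mem_normalCone hu)) hu ?_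
  rw [normal_gaussInv (normal_mem_normalCone hu), norm_normal hu, inv_one, one_smul]

theorem continuousAt_normalize {y : Euc n} (hy : y ≠ 0) :
    ContinuousAt (fun x : Euc n => ‖x‖⁻¹ • x) y :=
  (continuousAt_id.norm.inv₀ (norm_ne_zero_iff.2 hy)).smul continuousAt_id

/-- Injectivity of the Gauss map identifies the globally chosen inverse near y with a smooth local
inverse composed with normalization. -/
theorem StrictlyConvex.eventually_gaussInv (hS : S.StrictlyConvex) {y : Euc n}
    (hy : y ∈ S.normalCone) :
    (∀ᶠ x in 𝓝 y, x ∈ S.normalCone) ∧ ContDiffAt ℝ ∞ S.gaussInv y := by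
  obtain ⟨u, hu, huy⟩ := hy.2
  obtain ⟨G, hG, hGu, hGe⟩ := hS.exists_local_inverse hu
  rw [huy] at hG hGe hGu
  have h1 : ∀ᶠ x in 𝓝 y, ‖‖x‖⁻¹ • x‖ = 1 → G (‖x‖⁻¹ • x) ∈ S.carrier ∧
    S.normal (G (‖x‖⁻¹ • x)) = ‖x‖⁻¹ • x := (continuousAt_normalize hy.1).eventually hGe
  have h2 : ∀ᶠ x in 𝓝 y, x ∈ S.normalCone ∧ S.gaussInv x = G (‖x‖⁻¹ • x) := by
    filter_upwards [h1, isOpen_compl_singleton.mem_nhds hy.1] with x hx hx0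
    have hx0' : ‖x‖ ≠ 0 := norm_ne_zero_iff.2 hx0
    have hx2 := hx (by rw [norm_smul, norm_inv, norm_norm, inv_mul_cancel₀ hx0'])
    have hxc : x ∈ S.normalCone := ⟨hx0, _, hx2.1, hx2.2⟩
    refine ⟨hxc, hS.2 (gaussInv_mem hxc) hx2.1 ?_⟩
    rw [hx2.2, normal_gaussInv hxc]
  refine ⟨h2.mono fun x hx => hx.1, ?_⟩
  have h3 : ContDiffAt ℝ ∞ (fun x : Euc n => ‖x‖⁻¹ • x) y :=
    ((contDiffAt_norm ℝ hy.1).inv (norm_ne_zero_iff.2 hy.1)).smul contDiffAt_id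
  exact (ContDiffAt.comp (f := fun x : Euc n => ‖x‖⁻¹ • x) y hG h3).congr_of_eventuallyEq (h2.mono fun x hx => hx.2)

theorem StrictlyConvex.isOpen_normalCone (hS : S.StrictlyConvex) : IsOpen S.normalCone :=
  isOpen_iff_mem_nhds.2 fun _ hy => (hS.eventually_gaussInv hy).1

theorem StrictlyConvex.contDiffAt_gaussInv (hS : S.StrictlyConvex) {y : Euc n}
    (hy : y ∈ S.normalCone) : ContDiffAt ℝ ∞ S.gaussInv y :=
  (hS.eventually_gaussInv hy).2

/-- The differential of the inverse Gauss map takes tangential values and is positive definite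
transversally to the radial direction. -/
theorem StrictlyConvex.fderiv_gaussInv (hS : S.StrictlyConvex) {y : Euc n}
    (hy : y ∈ S.normalCone) (ξ : Euc n) :
    inner ℝ (fderiv ℝ S.gaussInv y ξ) y = 0 ∧
      ((∀ t : ℝ, ξ ≠ t • y) → 0 < inner ℝ (fderiv ℝ S.gaussInv y ξ) ξ) := by
  have hu := gaussInv_mem hy
  have hXD : HasFDerivAt S.gaussInv (fderiv ℝ S.gaussInv y) y :=
    ((hS.contDiffAt_gaussInv hy).differentiableAt (by simp)).hasFDerivAt
  set X := S.gaussInv with hX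
  set L := fderiv ℝ X y with hL
  obtain ⟨U, f, N, hU, huU, hf, hN, hN1, hfS, hNS, c, hc, hfu⟩ := S.exists_smooth_extension hu
  have hfD : DifferentiableAt ℝ f (X y) :=
    (hf.contDiffAt (hU.mem_nhds huU)).differentiableAt (by simp)
  have hND : DifferentiableAt ℝ N (X y) :=
    (hN.contDiffAt (hU.mem_nhds huU)).differentiableAt (by simp)
  have hy0 : ‖y‖ ≠ 0 := norm_ne_zero_iff.2 hy.1
  have hev : ∀ᶠ x in 𝓝 y, x ∈ S.normalCone ∧ X x ∈ U :=
    (hS.eventually_gaussInv hy).1.and (hXD.continuousAt.eventually (hU.mem_nhds huU))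
  have hNy : N (X y) = ‖y‖⁻¹ • y := by rw [← hNS _ huU hu, normal_gaussInv hy]
  have h1 : fderiv ℝ f (X y) (L ξ) = 0 := by
    have e1 := hfD.hasFDerivAt.comp y hXD
    have e2 : HasFDerivAt (f ∘ X) (0 : Euc n →L[ℝ] ℝ) y := by
      refine (hasFDerivAt_const (0 : ℝ) y).congr_of_eventuallyEq ?_
      filter_upwards [hev] with x hx
      exact (hfS _ hx.2).1 (gaussInv_mem hx.1)
    exact DFunLike.congr_fun (e1.unique e2) ξ
  have h2 : inner ℝ (L ξ) y = 0 := by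
    rw [hfu, hNy] at h1
    simp only [smul_apply, innerSL_apply_apply, inner_smul_left,
      smul_eq_mul, map_inv₀, conj_trivial] at h1
    rw [real_inner_comm]
    simpa [hc.ne', hy.1] using h1
  refine ⟨h2, fun hξ => ?_⟩
  -- Differentiation of ‖x‖ N(X x) = x. Pairing it with L ξ, which is orthogonal to y, leaves the
  -- quadratic form of the shape operator; it also shows that only radial ξ are killed by L.
  have h3 : ξ = ‖y‖ • fderiv ℝ N (X y) (L ξ) +
      (fderiv ℝ (fun x : Euc n => ‖x‖) y ξ) • (‖y‖⁻¹ • y) := by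
    have e0 : DifferentiableAt ℝ (fun x : Euc n => ‖x‖) y := differentiableAt_id.norm ℝ hy.1
    have e1 := e0.hasFDerivAt.smul (hND.hasFDerivAt.comp y hXD)
    have e2 : HasFDerivAt (fun x => ‖x‖ • (N ∘ X) x) (ContinuousLinearMap.id ℝ (Euc n)) y := by
      refine (hasFDerivAt_id y).congr_of_eventuallyEq ?_
      filter_upwards [hev] with x hx
      have : ‖x‖ ≠ 0 := norm_ne_zero_iff.2 hx.1.1
      rw [Function.comp, ← hNS _ hx.2 (gaussInv_mem hx.1), normal_gaussInv hx.1, smul_smul,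
        mul_inv_cancel₀ this, one_smul, id]
    have := DFunLike.congr_fun (e2.unique e1) ξ
    simpa [hNy] using this
  have h4 : L ξ ≠ 0 := by
    intro h0
    rw [h0, map_zero, smul_zero, zero_add, smul_smul] at h3
    exact hξ _ h3
  have hT : L ξ ∈ S.tangentSpace (X y) := by
    rw [mem_tangentSpace_iff, normal_gaussInv hy, inner_smul_left, real_inner_comm, h2, mul_zero]
  have h5 := hS.1 _ hu ⟨L ξ, hT⟩ (by simpa using h4)
  rw [shapeOperator_apply hu hU huU hf hND hfS hNS hc hfu] at h5
  have h6 : inner ℝ (L ξ) ξ = ‖y‖ * inner ℝ (fderiv ℝ N (X y) (L ξ)) (L ξ) := by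
    have := congrArg (inner ℝ (L ξ)) h3
    rw [inner_add_right, inner_smul_right, inner_smul_right, inner_smul_right, h2, mul_zero,
      mul_zero, add_zero, real_inner_comm] at this
    rw [real_inner_comm, this, real_inner_comm]
  rw [h6]
  exact mul_pos (norm_pos_iff.2 hy.1) h5

end Hypersurface

/-! ### Convexity of the cone of normals. -/

namespace Hypersurface

open Set Filter Topology Module

variable {n : ℕ} {S : Hypersurface n}

theorem GeodesicallyConvexNormals.neg_smul_notMem (hS : S.GeodesicallyConvexNormals) {y : Euc n}
    (hy : y ∈ S.normalCone) {t : ℝ} (ht : t < 0) : t • y ∉ S.normalCone := by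
  intro hty
  obtain ⟨u, hu, huy⟩ := hy.2
  obtain ⟨u', hu', huy'⟩ := hty.2
  refine hS.1 u hu u' hu' ?_
  have : ‖y‖ ≠ 0 := norm_ne_zero_iff.2 hy.1
  rw [huy, huy', norm_smul, Real.norm_of_nonpos ht.le, smul_smul, ← neg_smul]
  congr 1
  field_simp [ht.ne]

/-- If the ray of α y₁ + β y₂ misses the cone, then this ray and the ray of -y₂, which is excluded
by the antipodal condition, cut the great circle through y₁ and y₂ into two arcs that separate them.
This contradicts connectedness. -/
theorem GeodesicallyConvexNormals.add_mem_of_linearIndependent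
    (hS : S.GeodesicallyConvexNormals) {y₁ y₂ : Euc n} (h₁ : y₁ ∈ S.normalCone)
    (h₂ : y₂ ∈ S.normalCone) (hli : LinearIndependent ℝ ![y₁, y₂]) {α β : ℝ} (hα : 0 < α)
    (hβ : 0 < β) : α • y₁ + β • y₂ ∈ S.normalCone := by
  by_contra hy
  set P : Submodule ℝ (Euc n) := Submodule.span ℝ (range ![y₁, y₂]) with hP
  have hPr : finrank ℝ P = 2 := by
    rw [hP, finrank_span_eq_card hli, Fintype.card_fin]
  have hP1 : y₁ ∈ P := Submodule.subset_span ⟨0, rfl⟩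
  have hP2 : y₂ ∈ P := Submodule.subset_span ⟨1, rfl⟩
  have hconn := hS.2 P hPr
  -- Up to the Gram determinant Δ, pairing with v₁ and v₂ reads off the coordinates in the basis y₁,
  -- y₂ of P.
  set v₁ : Euc n := ‖y₂‖ ^ 2 • y₁ - inner ℝ y₁ y₂ • y₂ with hv₁
  set v₂ : Euc n := ‖y₁‖ ^ 2 • y₂ - inner ℝ y₁ y₂ • y₁ with hv₂
  set Δ : ℝ := ‖y₁‖ ^ 2 * ‖y₂‖ ^ 2 - inner ℝ y₁ y₂ ^ 2 with hΔ
  have e11 : inner ℝ y₁ v₁ = Δ := by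
    rw [hv₁, inner_sub_right, inner_smul_right, inner_smul_right, real_inner_self_eq_norm_sq]; ring
  have e21 : inner ℝ y₂ v₁ = 0 := by
    rw [hv₁, inner_sub_right, inner_smul_right, inner_smul_right, real_inner_self_eq_norm_sq,
      real_inner_comm y₁ y₂]
    ring
  have e12 : inner ℝ y₁ v₂ = 0 := by
    rw [hv₂, inner_sub_right, inner_smul_right, inner_smul_right, real_inner_self_eq_norm_sq]; ring
  have e22 : inner ℝ y₂ v₂ = Δ := by
    rw [hv₂, inner_sub_right, inner_smul_right, inner_smul_right, real_inner_self_eq_norm_sq,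
      real_inner_comm y₁ y₂]
    ring
  have hn1 : 0 < ‖y₁‖ ^ 2 := by have := norm_pos_iff.2 h₁.1; positivity
  have hΔpos : 0 < Δ := by
    have hv0 : v₂ ≠ 0 := by
      intro h0
      have := LinearIndependent.pair_iff.1 hli (-inner ℝ y₁ y₂) (‖y₁‖ ^ 2) (by
        rw [← h0, hv₂, neg_smul]; abel)
      exact hn1.ne' this.2
    have h1 : inner ℝ v₂ v₂ = ‖y₁‖ ^ 2 * Δ := by
      conv_lhs => rw [hv₂]
      rw [inner_sub_left, inner_smul_left, inner_smul_left, e12, e22]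
      simp
    rw [real_inner_self_eq_norm_sq] at h1
    have h2 : 0 < ‖v₂‖ ^ 2 := by have := norm_pos_iff.2 hv0; positivity
    rw [h1] at h2
    exact (mul_pos_iff_of_pos_left hn1).1 h2
  set A : Euc n → ℝ := fun w => inner ℝ w v₁ with hA
  set B : Euc n → ℝ := fun w => inner ℝ w v₂ with hB
  have hAc : Continuous A := by fun_prop
  have hBc : Continuous B := by fun_prop
  have hcoord : ∀ w ∈ P, ∃ a b : ℝ, w = a • y₁ + b • y₂ ∧ A w = a * Δ ∧ B w = b * Δ := by
    intro w hw
    rw [hP, Matrix.range_cons, Matrix.range_cons, Matrix.range_empty, union_empty,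
      singleton_union, Submodule.mem_span_pair] at hw
    obtain ⟨a, b, rfl⟩ := hw
    refine ⟨a, b, rfl, ?_, ?_⟩
    · simp only [hA, inner_add_left, inner_smul_left, e11, e21]; simp
    · simp only [hB, inner_add_left, inner_smul_left, e12, e22]; simp
  set Q := S.normal '' S.carrier ∩ (P : Set (Euc n)) with hQ
  have hQnorm : ∀ w ∈ Q, ‖w‖ = 1 := by
    rintro _ ⟨⟨u, hu, rfl⟩, -⟩
    exact norm_normal hu
  have hQcone : ∀ w ∈ Q, w ∈ S.normalCone := by
    rintro _ ⟨⟨u, hu, rfl⟩, -⟩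
    exact normal_mem_normalCone hu
  -- For w = a y₁ + b y₂ these are the conditions βa > αb and a > 0, against βa < αb or a < 0. Apart
  -- from the origin, only the two excluded rays of P lie in neither.
  set U₁ : Set (Euc n) := {w | 0 < β * A w - α * B w} ∩ {w | 0 < A w} with hU₁
  set U₂ : Set (Euc n) := {w | β * A w - α * B w < 0} ∪ {w | A w < 0} with hU₂
  have hU₁o : IsOpen U₁ := (isOpen_lt (by fun_prop) (by fun_prop)).inter
    (isOpen_lt (by fun_prop) (by fun_prop))
  have hU₂o : IsOpen U₂ := (isOpen_lt (by fun_prop) (by fun_prop)).union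
    (isOpen_lt (by fun_prop) (by fun_prop))
  have hcov : Q ⊆ U₁ ∪ U₂ := by
    intro w hw
    by_contra hcon
    obtain ⟨a, b, hwab, hAw, hBw⟩ := hcoord w hw.2
    simp only [hU₁, hU₂, mem_union, mem_inter_iff, mem_ofPred_eq, not_or, not_and, not_lt, hAw,
      hBw] at hcon
    have ha : 0 ≤ a := nonneg_of_mul_nonneg_left hcon.2.2 hΔpos
    have hab : 0 ≤ β * a - α * b := by
      have : 0 ≤ (β * a - α * b) * Δ := by linarith [hcon.2.1]
      exact nonneg_of_mul_nonneg_left this hΔpos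
    rcases ha.eq_or_lt with ha0 | ha0
    · have hb : b < 0 := by
        rcases lt_trichotomy b 0 with h | h | h
        · exact h
        · have := hQnorm w hw
          rw [hwab, ← ha0, h] at this
          simp at this
        · rw [← ha0] at hab; nlinarith
      have hwc := hQcone w hw
      rw [hwab, ← ha0, zero_smul, zero_add] at hwc
      exact hS.neg_smul_notMem h₂ hb hwc
    · have hab' : β * a = α * b := by
        by_contra hne
        have h1 : 0 < β * (a * Δ) - α * (b * Δ) := by
          have : 0 < β * a - α * b := lt_of_le_of_ne hab fun h => hne (by linarith)
          have := mul_pos this hΔpos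
          linarith
        have := hcon.1 h1
        nlinarith
      apply hy
      have hwc := smul_mem_normalCone (div_pos hα ha0) (hQcone w hw)
      convert hwc using 1
      rw [hwab, smul_add, smul_smul, smul_smul]
      congr 2
      · field_simp
      · field_simp; linarith
  have hmem : ∀ y, y ∈ S.normalCone → y ∈ P → ‖y‖⁻¹ • y ∈ Q := fun y h hP =>
    ⟨h.2, P.smul_mem _ hP⟩
  have hi1 : 0 < ‖y₁‖⁻¹ := inv_pos.2 (norm_pos_iff.2 h₁.1)
  have hi2 : 0 < ‖y₂‖⁻¹ := inv_pos.2 (norm_pos_iff.2 h₂.1)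
  obtain ⟨w, -, hw1, hw2⟩ := hconn U₁ U₂ hU₁o hU₂o hcov
    ⟨_, hmem y₁ h₁ hP1, by
      simp only [hU₁, mem_inter_iff, mem_ofPred_eq, hA, hB, inner_smul_left, e11, e12]
      simp only [conj_trivial, mul_zero, sub_zero]
      exact ⟨by positivity, by positivity⟩⟩
    ⟨_, hmem y₂ h₂ hP2, by
      left
      simp only [mem_ofPred_eq, hA, hB, inner_smul_left, e21, e22]
      simp only [conj_trivial, mul_zero, zero_sub, neg_lt_zero]
      positivity⟩
  simp only [hU₁, hU₂, mem_inter_iff, mem_union, mem_ofPred_eq] at hw1 hw2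
  rcases hw2 with hw2 | hw2
  · exact lt_asymm hw1.1 hw2
  · exact lt_asymm hw1.2 hw2

theorem GeodesicallyConvexNormals.convex_normalCone (hS : S.GeodesicallyConvexNormals) :
    Convex ℝ S.normalCone := by
  intro y₁ h₁ y₂ h₂ α β hα hβ hαβ
  rcases hα.eq_or_lt with rfl | hα
  · rw [zero_smul, zero_add]
    exact smul_mem_normalCone (by linarith) h₂
  rcases hβ.eq_or_lt with rfl | hβ
  · rw [zero_smul, add_zero]
    exact smul_mem_normalCone hα h₁
  by_cases hli : LinearIndependent ℝ ![y₁, y₂]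
  · exact hS.add_mem_of_linearIndependent h₁ h₂ hli hα hβ
  · rw [LinearIndependent.pair_iff' h₁.1] at hli
    push Not at hli
    obtain ⟨t, rfl⟩ := hli
    have ht : 0 < t := by
      rcases lt_trichotomy t 0 with h | h | h
      · exact absurd h₂ (hS.neg_smul_notMem h₁ h)
      · exact absurd (by rw [h, zero_smul]) h₂.1
      · exact h
    rw [smul_smul, ← add_smul]
    exact smul_mem_normalCone (by positivity) h₁

/-- The unit normals lie in an open hemisphere. -/
theorem exists_pole (hn : 2 ≤ n) (hS : S.StrictlyConvex) (hS' : S.GeodesicallyConvexNormals) :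
    ∃ e : Euc n, ‖e‖ = 1 ∧ ∀ y ∈ S.normalCone, 0 < inner ℝ y e := by
  have : Nontrivial (Euc n) := by
    have : Nontrivial (Fin n) := Fin.nontrivial_iff_two_le.2 hn
    have : Nonempty (Fin n) := inferInstance
    infer_instance
  rcases S.normalCone.eq_empty_or_nonempty with h0 | ⟨y₀, hy₀⟩
  · obtain ⟨e, he⟩ := exists_norm_eq (Euc n) zero_le_one
    exact ⟨e, he, by simp [h0]⟩
  -- The cone is open and convex and omits 0, so a linear functional is strictly negative on it; the
  -- pole is its negated, normalized gradient.
  obtain ⟨f, hf⟩ := geometric_hahn_banach_open_point hS'.convex_normalCone hS.isOpen_normalCone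
    (x := 0) (fun h => h.1 rfl)
  rw [map_zero] at hf
  set e₀ : Euc n := -(InnerProductSpace.toDual ℝ (Euc n)).symm f with he₀
  have he : ∀ y, inner ℝ y e₀ = -f y := fun y => by
    rw [he₀, inner_neg_right, real_inner_comm, InnerProductSpace.toDual_symm_apply]
  have he0 : e₀ ≠ 0 := by
    intro h
    have := he y₀
    rw [h, inner_zero_right] at this
    linarith [hf y₀ hy₀]
  refine ⟨‖e₀‖⁻¹ • e₀, ?_, fun y hy => ?_⟩
  · rw [norm_smul, norm_inv, norm_norm, inv_mul_cancel₀ (norm_ne_zero_iff.2 he0)]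
  · rw [inner_smul_right, he]
    have := hf y hy
    have := inv_pos.2 (norm_pos_iff.2 he0)
    exact mul_pos this (by linarith)

end Hypersurface

/-! ### The chord map in central projection, and its injectivity. -/

open Set Filter Topology Module

/-- The determinant of a block triangular endomorphism of a product. -/
theorem det_eq_det_of_snd {E₁ E₂ : Type*} [AddCommGroup E₁] [Module ℝ E₁]
    [FiniteDimensional ℝ E₁] [AddCommGroup E₂] [Module ℝ E₂] [FiniteDimensional ℝ E₂]
    (L : E₁ × E₂ →ₗ[ℝ] E₁ × E₂) (hL : ∀ p, (L p).2 = p.2) :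
    L.det = (LinearMap.fst ℝ E₁ E₂ ∘ₗ L ∘ₗ LinearMap.inl ℝ E₁ E₂).det := by
  let b := Module.Free.chooseBasis ℝ E₁
  let b' := Module.Free.chooseBasis ℝ E₂
  have h : LinearMap.toMatrix (b.prod b') (b.prod b') L = Matrix.fromBlocks
      (LinearMap.toMatrix b b (LinearMap.fst ℝ E₁ E₂ ∘ₗ L ∘ₗ LinearMap.inl ℝ E₁ E₂))
      (LinearMap.toMatrix b' b (LinearMap.fst ℝ E₁ E₂ ∘ₗ L ∘ₗ LinearMap.inr ℝ E₁ E₂)) 0 1 := by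
    ext i j
    rcases i with i | i <;> rcases j with j | j <;>
      simp [LinearMap.toMatrix_apply, hL, Matrix.one_apply, Finsupp.single_apply, eq_comm]
  rw [← LinearMap.det_toMatrix (b.prod b'), h, Matrix.det_fromBlocks_zero₂₁, Matrix.det_one,
    mul_one, LinearMap.det_toMatrix]

/-- A chart of a strictly convex hypersurface by its unit normals, in central projection: the
normal at `map z` points in the direction `pole + incl z`. -/
structure GaussChart (E F : Type*) [NormedAddCommGroup E] [InnerProductSpace ℝ E]
    [NormedAddCommGroup F] [InnerProductSpace ℝ F] where
  /-- the centre of the hemisphere containing the normals -/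
  pole : F
  /-- the parameter space as a subspace of the ambient space -/
  incl : E →ₗᵢ[ℝ] F
  /-- the set of parameters -/
  dom : Set E
  /-- the parametrization -/
  map : E → F
  norm_pole : ‖pole‖ = 1
  inner_pole : ∀ z, inner ℝ pole (incl z) = 0
  isOpen_dom : IsOpen dom
  convex_dom : Convex ℝ dom
  contDiffAt : ∀ z ∈ dom, ContDiffAt ℝ ∞ map z
  inner_fderiv : ∀ z ∈ dom, ∀ ξ, inner ℝ (fderiv ℝ map z ξ) (pole + incl z) = 0
  inner_fderiv_pos : ∀ z ∈ dom, ∀ ξ, ξ ≠ 0 → 0 < inner ℝ (fderiv ℝ map z ξ) (incl ξ)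

namespace GaussChart

variable {E F : Type*} [NormedAddCommGroup E] [InnerProductSpace ℝ E]
  [NormedAddCommGroup F] [InnerProductSpace ℝ F] (c : GaussChart E F)

/-- The direction of the normal at the point with parameter `z`. -/
def dir (z : E) : F := c.pole + c.incl z

variable {c}

theorem hasFDerivAt_map {z : E} (hz : z ∈ c.dom) : HasFDerivAt c.map (fderiv ℝ c.map z) z :=
  ((c.contDiffAt z hz).differentiableAt (by simp)).hasFDerivAt

theorem injective_fderiv_map {z : E} (hz : z ∈ c.dom) :
    Function.Injective (fderiv ℝ c.map z) := by
  rw [injective_iff_map_eq_zero]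
  intro ξ hξ
  by_contra hne
  have := c.inner_fderiv_pos z hz ξ hne
  rw [hξ, inner_zero_left] at this
  exact lt_irrefl _ this

/-- A point of the hypersurface lies beyond all others in the direction of its normal. -/
theorem inner_sub_dir_pos {z z' : E} (hz : z ∈ c.dom) (hz' : z' ∈ c.dom) (hne : z ≠ z') :
    0 < inner ℝ (c.map z' - c.map z) (c.dir z') := by
  set ξ := z' - z with hξ
  have hξ0 : ξ ≠ 0 := sub_ne_zero.2 hne.symm
  have hmem : ∀ t ∈ Icc (0 : ℝ) 1, z + t • ξ ∈ c.dom := fun t ht =>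
    c.convex_dom.add_smul_sub_mem hz hz' ht
  -- The direction at z' is the one at z + tξ plus (1 - t) incl ξ. The first part is normal to the
  -- velocity, so h' = (1 - t)⟨dX ξ, ξ⟩ > 0 for t < 1.
  set h : ℝ → ℝ := fun t => inner ℝ (c.map (z + t • ξ)) (c.dir z') with hh
  have hd : ∀ t ∈ Icc (0 : ℝ) 1,
      HasDerivAt h ((1 - t) * inner ℝ (fderiv ℝ c.map (z + t • ξ) ξ) (c.incl ξ)) t := by
    intro t ht
    have h1 : HasDerivAt (fun t : ℝ => z + t • ξ) ξ t := by
      simpa using ((hasDerivAt_id t).smul_const ξ).const_add z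
    have h2 := (hasFDerivAt_map (hmem t ht)).comp_hasDerivAt t h1
    have h3 := h2.inner ℝ (hasDerivAt_const t (c.dir z'))
    convert! h3 using 1
    have h4 : c.dir z' = (c.pole + c.incl (z + t • ξ)) + (1 - t) • c.incl ξ := by
      have : z' = z + ξ := by rw [hξ]; abel
      rw [dir, this, map_add, map_add, map_smul]
      module
    rw [h4, inner_zero_right, zero_add, inner_add_right, c.inner_fderiv _ (hmem t ht), zero_add,
      inner_smul_right]
  have hmono : StrictMonoOn h (Icc 0 1) := by
    refine strictMonoOn_of_deriv_pos (convex_Icc 0 1)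
      (fun t ht => (hd t ht).continuousAt.continuousWithinAt) fun t ht => ?_
    rw [interior_Icc] at ht
    have ht' : t ∈ Icc (0 : ℝ) 1 := Ioo_subset_Icc_self ht
    rw [(hd t ht').deriv]
    exact mul_pos (by linarith [ht.2]) (c.inner_fderiv_pos _ (hmem t ht') ξ hξ0)
  have := hmono (left_mem_Icc.2 zero_le_one) (right_mem_Icc.2 zero_le_one) zero_lt_one
  simp only [hh, zero_smul, add_zero, one_smul] at this
  rw [show z + ξ = z' by rw [hξ]; abel] at this
  rw [inner_sub_left]
  linarith

theorem injOn_map : InjOn c.map c.dom := by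
  intro z hz z' hz' h
  by_contra hne
  have := inner_sub_dir_pos hz hz' hne
  rw [h, sub_self, inner_zero_left] at this
  exact lt_irrefl _ this

variable (c) in
/-- Pairs of distinct parameters. -/
def pairs : Set (E × E) := {p | p.1 ∈ c.dom ∧ p.2 ∈ c.dom ∧ p.1 ≠ p.2}

variable (c) in
/-- The relative position of `mid p` on the segment from `p.2` to `p.1`. -/
def weight (p : E × E) : ℝ :=
  inner ℝ (c.map p.2 - c.map p.1) (c.dir p.2) /
    (inner ℝ (c.map p.2 - c.map p.1) (c.dir p.2) + inner ℝ (c.map p.1 - c.map p.2) (c.dir p.1))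

variable (c) in
/-- The parameter between `p.1` and `p.2` whose normal is orthogonal to the chord. -/
def mid (p : E × E) : E := p.2 + c.weight p • (p.1 - p.2)

variable (c) in
/-- The map `(u'', u') ↦ (u, u')`, in parameters, where `u'' = R_u u'`. -/
def midPair (p : E × E) : E × E := (c.mid p, p.2)

theorem isOpen_pairs : IsOpen c.pairs := by
  have : c.pairs = (c.dom ×ˢ c.dom) ∩ {p | p.1 ≠ p.2} := by
    ext p; simp [pairs, and_assoc]
  rw [this]
  exact (c.isOpen_dom.prod c.isOpen_dom).inter (isOpen_ne_fun continuous_fst continuous_snd)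

theorem weight_mem {p : E × E} (hp : p ∈ c.pairs) : 0 < c.weight p ∧ c.weight p < 1 := by
  have h1 := inner_sub_dir_pos hp.1 hp.2.1 hp.2.2
  have h2 := inner_sub_dir_pos hp.2.1 hp.1 (Ne.symm hp.2.2)
  refine ⟨div_pos h1 (by linarith), (div_lt_one (by linarith)).2 (by linarith)⟩

/-- The pairing is affine in s with values of opposite sign at s = 0 and s = 1, so it has a single
root, and `weight` is that root. All real s are allowed, which later gives uniqueness on the whole
line. -/
theorem inner_chord_eq_zero_iff {p : E × E} (hp : p ∈ c.pairs) (s : ℝ) :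
    inner ℝ (c.map p.2 - c.map p.1) (c.dir (p.2 + s • (p.1 - p.2))) = 0 ↔ s = c.weight p := by
  have h1 := inner_sub_dir_pos hp.1 hp.2.1 hp.2.2
  have h2 := inner_sub_dir_pos hp.2.1 hp.1 (Ne.symm hp.2.2)
  have h3 : c.dir (p.2 + s • (p.1 - p.2)) = (1 - s) • c.dir p.2 + s • c.dir p.1 := by
    simp only [dir, map_add, map_smul, map_sub]
    module
  have h4 : inner ℝ (c.map p.2 - c.map p.1) (c.dir p.1) =
      -inner ℝ (c.map p.1 - c.map p.2) (c.dir p.1) := by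
    rw [← inner_neg_left, neg_sub]
  rw [h3, inner_add_right, inner_smul_right, inner_smul_right, h4, weight, eq_div_iff (by linarith)]
  constructor <;> intro h <;> linarith

theorem inner_chord_mid {p : E × E} (hp : p ∈ c.pairs) :
    inner ℝ (c.map p.2 - c.map p.1) (c.dir (c.mid p)) = 0 :=
  (inner_chord_eq_zero_iff hp _).2 rfl

theorem mid_mem {p : E × E} (hp : p ∈ c.pairs) : c.mid p ∈ c.dom :=
  c.convex_dom.add_smul_sub_mem hp.2.1 hp.1 ⟨(weight_mem hp).1.le, (weight_mem hp).2.le⟩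

theorem mid_ne {p : E × E} (hp : p ∈ c.pairs) : c.mid p ≠ p.2 := by
  intro h
  rw [mid, add_eq_left, smul_eq_zero, sub_eq_zero] at h
  exact h.elim (weight_mem hp).1.ne' hp.2.2

/-- Suppose x ≠ y have the same mid m with z. Then x, y, z, m are collinear and, by subtraction, the
chord from x to y is orthogonal to the direction at m too, so m is also the mid of x and y. But one
point cannot lie strictly between each two of three collinear points. -/
theorem injOn_midPair : InjOn c.midPair c.pairs := by
  rintro ⟨x, z⟩ hx ⟨y, z'⟩ hy h
  obtain ⟨hm, rfl⟩ : c.mid (x, z) = c.mid (y, z') ∧ z = z' := by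
    simpa [midPair] using h
  by_contra hne
  have hxy : x ≠ y := fun h => hne (by rw [h])
  have hp : (x, y) ∈ c.pairs := ⟨hx.1, hy.1, hxy⟩
  have e1 := inner_chord_mid hx
  have e2 := inner_chord_mid hy
  rw [← hm] at e2
  have wx := weight_mem hx
  have wy := weight_mem hy
  set m := c.mid (x, z) with hmdef
  set s := c.weight (x, z) with hs
  set t := c.weight (y, z) with ht
  have hmx : m = z + s • (x - z) := rfl
  have hmy : m = z + t • (y - z) := hm
  have e3 : inner ℝ (c.map y - c.map x) (c.dir m) = 0 := by
    have : c.map y - c.map x = (c.map z - c.map x) - (c.map z - c.map y) := by abel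
    rw [this, inner_sub_left, e1, e2, sub_zero]
  have hst : s ≠ t := by
    intro hst
    rw [hmx, ← hst] at hmy
    have := smul_right_injective E wx.1.ne' (add_left_cancel hmy)
    exact hxy (sub_left_injective this)
  -- The position of m on the segment from y to x, solved from m = z + s(x - z) = z + t(y - z). It
  -- falls outside (0, 1) for every s ≠ t in (0, 1).
  set r : ℝ := s * (1 - t) / (s - t) with hr
  have hst' : s - t ≠ 0 := sub_ne_zero.2 hst
  have hmr : m = y + r • (x - y) := by
    have h1 : (s - t) • m = (s - t) • (y + r • (x - y)) := by
      have e1 : t • m = t • z + (t * s) • (x - z) := by rw [hmx]; module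
      have e2 : s • m = s • z + (s * t) • (y - z) := by rw [hmy]; module
      have e3 : s • (z + s • (x - z)) = s • (z + t • (y - z)) := by rw [← hmx, ← hmy]
      have e4 : (s - t) • r • (x - y) = (s * (1 - t)) • (x - y) := by
        rw [smul_smul, hr, mul_div_cancel₀ _ hst']
      have e5 : s • (x - z) = t • (y - z) := by
        have := hmx.symm.trans hmy
        exact add_left_cancel this
      have e6 : s • x = s • z + t • y - t • z := by
        rw [smul_sub, smul_sub] at e5
        rw [sub_eq_iff_eq_add] at e5
        rw [e5]; abel
      rw [sub_smul, smul_add, e4, e1, e2]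
      have e7 : (s * (1 - t)) • (x - y) = (1 - t) • (s • x) - (s * (1 - t)) • y := by module
      have e8 : (t * s) • (x - z) = t • (s • x) - (t * s) • z := by module
      rw [e7, e8, e6]
      module
    exact smul_right_injective E hst' h1
  rw [hmr] at e3
  have h5 := (inner_chord_eq_zero_iff hp r).1 e3
  have h6 := weight_mem hp
  rw [← h5, hr] at h6
  rcases lt_or_gt_of_ne hst with hlt | hlt
  · have := div_neg_of_pos_of_neg (mul_pos wx.1 (by linarith [wy.2] : 0 < 1 - t))
      (sub_neg.2 hlt)
    linarith [h6.1]
  · have := (div_lt_one (sub_pos.2 hlt)).1 h6.2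
    nlinarith [wx.2, wy.1]

theorem contDiffAt_weight {p : E × E} (hp : p ∈ c.pairs) : ContDiffAt ℝ ∞ c.weight p := by
  have h1 : ContDiffAt ℝ ∞ (fun p : E × E => c.map p.1) p :=
    (c.contDiffAt _ hp.1).comp p contDiffAt_fst
  have h2 : ContDiffAt ℝ ∞ (fun p : E × E => c.map p.2) p :=
    (c.contDiffAt _ hp.2.1).comp p contDiffAt_snd
  have hd : ContDiff ℝ ∞ c.dir := contDiff_const.add c.incl.toContinuousLinearMap.contDiff
  have hd1 : ContDiffAt ℝ ∞ (fun p : E × E => c.dir p.1) p :=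
    hd.contDiffAt.comp p contDiffAt_fst
  have hd2 : ContDiffAt ℝ ∞ (fun p : E × E => c.dir p.2) p :=
    hd.contDiffAt.comp p contDiffAt_snd
  have e1 := inner_sub_dir_pos hp.1 hp.2.1 hp.2.2
  have e2 := inner_sub_dir_pos hp.2.1 hp.1 (Ne.symm hp.2.2)
  exact ((h2.sub h1).inner ℝ hd2).div (((h2.sub h1).inner ℝ hd2).add ((h1.sub h2).inner ℝ hd1))
    (by linarith)

theorem contDiffAt_mid {p : E × E} (hp : p ∈ c.pairs) : ContDiffAt ℝ ∞ c.mid p :=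
  contDiffAt_snd.add ((contDiffAt_weight hp).smul (contDiffAt_fst.sub contDiffAt_snd))

theorem contDiffAt_midPair {p : E × E} (hp : p ∈ c.pairs) : ContDiffAt ℝ ∞ c.midPair p :=
  (contDiffAt_mid hp).prodMk contDiffAt_snd

theorem fderiv_midPair {p : E × E} (hp : p ∈ c.pairs) (q : E × E) :
    fderiv ℝ c.midPair p q = (fderiv ℝ c.mid p q, q.2) := by
  have h := ((contDiffAt_mid hp).differentiableAt (by simp)).hasFDerivAt.prodMk
    (hasFDerivAt_snd (p := p))
  rw [show c.midPair = fun p => (c.mid p, p.2) from rfl, h.fderiv]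
  rfl

/-- An infinitesimal motion ξ of the first point that fixes z' and the mid must be parallel to the
segment. Differentiating the orthogonality relation and using tangency at the first point leaves ⟨dX
ξ, incl (p.1 - p.2)⟩ = 0, and positivity then forces ξ = 0. -/
theorem injective_fderiv_midPair {p : E × E} (hp : p ∈ c.pairs) :
    Function.Injective (fderiv ℝ c.midPair p) := by
  rw [injective_iff_map_eq_zero]
  rintro ⟨ξ, η⟩ hξ
  rw [fderiv_midPair hp, Prod.mk_eq_zero] at hξ
  obtain ⟨hm, rfl⟩ := hξ
  have hmD := ((contDiffAt_mid hp).differentiableAt (by simp)).hasFDerivAt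
  have hwD := ((contDiffAt_weight hp).differentiableAt (by simp)).hasFDerivAt
  have hw := weight_mem hp
  have e1 : fderiv ℝ c.mid p (ξ, 0) =
      c.weight p • ξ + fderiv ℝ c.weight p (ξ, 0) • (p.1 - p.2) := by
    have h := (hasFDerivAt_snd (p := p)).add
      (hwD.smul ((hasFDerivAt_fst (p := p)).sub (hasFDerivAt_snd (p := p))))
    have h' : HasFDerivAt c.mid _ p := h
    rw [h'.fderiv]
    simp
  set a : ℝ := -(fderiv ℝ c.weight p (ξ, 0) / c.weight p) with ha
  have e2 : ξ = a • (p.1 - p.2) := by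
    rw [hm] at e1
    have : c.weight p • ξ = c.weight p • a • (p.1 - p.2) := by
      rw [smul_smul, ha, mul_neg, mul_div_cancel₀ _ hw.1.ne', neg_smul]
      exact eq_neg_of_add_eq_zero_left e1.symm
    exact smul_right_injective E hw.1.ne' this
  have e3 : inner ℝ (fderiv ℝ c.map p.1 ξ) (c.dir (c.mid p)) = 0 := by
    have h1 := (hasFDerivAt_map hp.1).comp p (hasFDerivAt_fst (p := p))
    have h2 := (hasFDerivAt_map hp.2.1).comp p (hasFDerivAt_snd (p := p))
    have h3 := (c.incl.toContinuousLinearMap.hasFDerivAt.comp p hmD).const_add c.pole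
    have h4 := (h2.sub h1).inner ℝ h3
    have h5 : HasFDerivAt (fun q : E × E => inner ℝ (c.map q.2 - c.map q.1) (c.dir (c.mid q)))
        (0 : E × E →L[ℝ] ℝ) p := by
      refine (hasFDerivAt_const (0 : ℝ) p).congr_of_eventuallyEq ?_
      filter_upwards [isOpen_pairs.mem_nhds hp] with q hq
      exact inner_chord_mid hq
    have h6 := DFunLike.congr_fun (h4.unique h5) (ξ, 0)
    simp [hm] at h6
    exact h6
  have e4 : c.dir (c.mid p) = (c.pole + c.incl p.1) - (1 - c.weight p) • c.incl (p.1 - p.2) := by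
    simp only [dir, mid, map_add, map_smul, map_sub]
    module
  rw [e4, inner_sub_right, c.inner_fderiv _ hp.1, inner_smul_right, zero_sub, neg_eq_zero,
    mul_eq_zero, or_iff_right (by linarith [hw.2]), e2, map_smul, inner_smul_left] at e3
  have e5 := c.inner_fderiv_pos p.1 hp.1 (p.1 - p.2) (sub_ne_zero.2 hp.2.2)
  have ha0 : a = 0 := (mul_eq_zero.1 e3).resolve_right e5.ne'
  rw [e2, ha0, zero_smul, Prod.mk_zero_zero]

/-! ### The inverse of the chord map. -/

section Inverse

variable (c) in
/-- The set of pairs `(u, u')`, in parameters, for which `R_u u'` exists. -/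
def reflDomain : Set (E × E) := c.midPair '' c.pairs

variable (c) in
/-- The map `(u, u') ↦ (R_u u', u')`, in parameters. -/
def reflPair : E × E → E × E := Function.invFunOn c.midPair c.pairs

theorem reflPair_mem {q : E × E} (hq : q ∈ c.reflDomain) : c.reflPair q ∈ c.pairs :=
  Function.invFunOn_mem hq

theorem midPair_reflPair {q : E × E} (hq : q ∈ c.reflDomain) : c.midPair (c.reflPair q) = q :=
  Function.invFunOn_eq hq

theorem reflPair_midPair {p : E × E} (hp : p ∈ c.pairs) : c.reflPair (c.midPair p) = p :=
  injOn_midPair.leftInvOn_invFunOn hp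

theorem reflPair_snd {q : E × E} (hq : q ∈ c.reflDomain) : (c.reflPair q).2 = q.2 := by
  conv_rhs => rw [← midPair_reflPair hq]
  rfl

variable [FiniteDimensional ℝ E]

/-- The differential of `midPair`, as an equivalence. -/
def midPairDeriv {p : E × E} (hp : p ∈ c.pairs) : (E × E) ≃L[ℝ] (E × E) :=
  (LinearEquiv.ofInjectiveEndo (fderiv ℝ c.midPair p : E × E →ₗ[ℝ] E × E)
    (injective_fderiv_midPair hp)).toContinuousLinearEquiv

theorem hasStrictFDerivAt_midPair {p : E × E} (hp : p ∈ c.pairs) :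
    HasStrictFDerivAt c.midPair (midPairDeriv hp : E × E →L[ℝ] E × E) p := by
  convert! (contDiffAt_midPair hp).hasStrictFDerivAt (by simp) using 1

/-- By global injectivity, the chosen inverse agrees near each image point with the one from the
inverse function theorem. -/
theorem eventually_reflPair {p : E × E} (hp : p ∈ c.pairs) :
    (∀ᶠ q in 𝓝 (c.midPair p), q ∈ c.reflDomain) ∧
      HasStrictFDerivAt c.reflPair ((midPairDeriv hp).symm : E × E →L[ℝ] E × E)
        (c.midPair p) := by
  have hs := hasStrictFDerivAt_midPair hp
  have hG : Tendsto (hs.localInverse c.midPair _ p) (𝓝 (c.midPair p)) (𝓝 p) := by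
    have := hs.localInverse_continuousAt
    rwa [ContinuousAt, hs.localInverse_apply_image] at this
  have hev : ∀ᶠ q in 𝓝 (c.midPair p), q ∈ c.reflDomain ∧
      hs.localInverse c.midPair _ p q = c.reflPair q := by
    filter_upwards [hs.eventually_right_inverse, hG.eventually (isOpen_pairs.mem_nhds hp)]
      with q h1 h2
    have hq : q ∈ c.reflDomain := ⟨_, h2, h1⟩
    exact ⟨hq, injOn_midPair h2 (reflPair_mem hq) (h1.trans (midPair_reflPair hq).symm)⟩
  exact ⟨hev.mono fun q h => h.1, hs.to_localInverse.congr_of_eventuallyEq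
    (hev.mono fun q h => h.2)⟩

theorem isOpen_reflDomain : IsOpen c.reflDomain := by
  rw [isOpen_iff_mem_nhds]
  rintro _ ⟨p, hp, rfl⟩
  exact (eventually_reflPair hp).1

theorem continuousOn_reflPair : ContinuousOn c.reflPair c.reflDomain := by
  rintro _ ⟨p, hp, rfl⟩
  exact (eventually_reflPair hp).2.continuousAt.continuousWithinAt

end Inverse

end GaussChart

/-! ### The chart of S by central projection of its normals. -/

open Set Filter Topology Module

/-- A Gauss chart parametrizes all of the hypersurface `S`, with the unit normals of `S`. -/
structure GaussChart.Charts {n : ℕ} {E : Type*} [NormedAddCommGroup E] [InnerProductSpace ℝ E]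
    (c : GaussChart E (Euc n)) (S : Hypersurface n) : Prop where
  image_map : c.map '' c.dom = S.carrier
  normal_map : ∀ z ∈ c.dom, S.normal (c.map z) = ‖c.dir z‖⁻¹ • c.dir z
  finrank_eq : finrank ℝ E = n - 1

namespace Hypersurface

variable {n : ℕ} {S : Hypersurface n}

theorem differentiableWithinAt_normal {u : Euc n} (hu : u ∈ S.carrier) :
    DifferentiableWithinAt ℝ S.normal S.carrier u := by
  obtain ⟨U, f, N, hU, huU, -, hN, -, -, hNS, -⟩ := S.exists_smooth_extension hu
  have hND : DifferentiableAt ℝ N u :=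
    (hN.contDiffAt (hU.mem_nhds huU)).differentiableAt (by simp)
  refine (hND.differentiableWithinAt (s := S.carrier)).congr_of_eventuallyEq ?_ (hNS u huU hu)
  filter_upwards [self_mem_nhdsWithin, mem_nhdsWithin_of_mem_nhds (hU.mem_nhds huU)] with x h1 h2
  exact hNS x h2 h1

/-- The chart of a strictly convex hypersurface given by central projection of its normals. -/
def gaussChart (hS : S.StrictlyConvex) (hS' : S.GeodesicallyConvexNormals) {e : Euc n}
    (he : ‖e‖ = 1) : GaussChart (ℝ ∙ e)ᗮ (Euc n) where
  pole := e
  incl := (ℝ ∙ e)ᗮ.subtypeₗᵢ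
  dom := {z | e + (z : Euc n) ∈ S.normalCone}
  map z := S.gaussInv (e + (z : Euc n))
  norm_pole := he
  inner_pole z := Submodule.mem_orthogonal_singleton_iff_inner_right.1 z.2
  isOpen_dom := hS.isOpen_normalCone.preimage (by fun_prop)
  convex_dom := by
    intro x hx y hy a b ha hb hab
    have := hS'.convex_normalCone hx hy ha hb hab
    have h2 : a • (e + (x : Euc n)) + b • (e + (y : Euc n)) =
        e + ((a • x + b • y : (ℝ ∙ e)ᗮ) : Euc n) := by
      rw [Submodule.coe_add, Submodule.coe_smul, Submodule.coe_smul, smul_add, smul_add,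
        add_add_add_comm, ← add_smul, hab, one_smul]
    rw [h2] at this
    exact this
  contDiffAt z hz := by
    have h1 : ContDiffAt ℝ ∞ (fun z : (ℝ ∙ e)ᗮ => e + (z : Euc n)) z :=
      contDiffAt_const.add (ℝ ∙ e)ᗮ.subtypeL.contDiff.contDiffAt
    exact ContDiffAt.comp (g := S.gaussInv) (f := fun z : (ℝ ∙ e)ᗮ => e + (z : Euc n)) z
      (hS.contDiffAt_gaussInv hz) h1
  inner_fderiv z hz ξ := by
    have h1 : HasFDerivAt (fun z : (ℝ ∙ e)ᗮ => e + (z : Euc n)) (ℝ ∙ e)ᗮ.subtypeL z :=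
      (ℝ ∙ e)ᗮ.subtypeL.hasFDerivAt.const_add e
    have h2 := (((hS.contDiffAt_gaussInv hz).differentiableAt (by simp)).hasFDerivAt.comp z h1)
    have h3 : HasFDerivAt (fun z : (ℝ ∙ e)ᗮ => S.gaussInv (e + (z : Euc n))) _ z := h2
    rw [h3.fderiv]
    exact (hS.fderiv_gaussInv hz ξ).1
  inner_fderiv_pos z hz ξ hξ := by
    have h1 : HasFDerivAt (fun z : (ℝ ∙ e)ᗮ => e + (z : Euc n)) (ℝ ∙ e)ᗮ.subtypeL z :=
      (ℝ ∙ e)ᗮ.subtypeL.hasFDerivAt.const_add e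
    have h2 := (((hS.contDiffAt_gaussInv hz).differentiableAt (by simp)).hasFDerivAt.comp z h1)
    have h3 : HasFDerivAt (fun z : (ℝ ∙ e)ᗮ => S.gaussInv (e + (z : Euc n))) _ z := h2
    rw [h3.fderiv]
    -- A radial vector t(e + z) has component t along e, so it is orthogonal to e only when it
    -- vanishes.
    refine (hS.fderiv_gaussInv hz ξ).2 fun t ht => hξ ?_
    have h4 : inner ℝ e (ξ : Euc n) = 0 :=
      Submodule.mem_orthogonal_singleton_iff_inner_right.1 ξ.2
    have h5 : inner ℝ e (z : Euc n) = 0 :=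
      Submodule.mem_orthogonal_singleton_iff_inner_right.1 z.2
    rw [ht, inner_smul_right, inner_add_right, h5, real_inner_self_eq_norm_sq, he] at h4
    have ht0 : t = 0 := by simpa using h4
    rw [ht0, zero_smul] at ht
    exact Subtype.ext ht

theorem charts_gaussChart (hS : S.StrictlyConvex) (hS' : S.GeodesicallyConvexNormals) {e : Euc n}
    (he : ‖e‖ = 1) (hpos : ∀ y ∈ S.normalCone, 0 < inner ℝ y e) :
    (gaussChart hS hS' he).Charts S where
  image_map := by
    refine Subset.antisymm ?_ ?_
    · rintro _ ⟨z, hz, rfl⟩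
      exact gaussInv_mem hz
    · intro u hu
      have hN := normal_mem_normalCone hu
      have hp := hpos _ hN
      set t : ℝ := (inner ℝ (S.normal u) e)⁻¹ with ht
      have ht0 : 0 < t := inv_pos.2 hp
      have hz : t • S.normal u - e ∈ (ℝ ∙ e)ᗮ := by
        rw [Submodule.mem_orthogonal_singleton_iff_inner_left, inner_sub_left, inner_smul_left,
          real_inner_self_eq_norm_sq, he, conj_trivial, ht, inv_mul_cancel₀ hp.ne']
        norm_num
      refine ⟨⟨_, hz⟩, ?_, ?_⟩
      · change e + (t • S.normal u - e) ∈ S.normalCone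
        rw [add_sub_cancel]
        exact smul_mem_normalCone ht0 hN
      · change S.gaussInv (e + (t • S.normal u - e)) = u
        rw [add_sub_cancel, gaussInv_smul ht0, hS.gaussInv_normal hu]
  normal_map z hz := normal_gaussInv hz
  finrank_eq := by
    have h1 := (ℝ ∙ e).finrank_add_finrank_orthogonal
    have h2 : finrank ℝ (ℝ ∙ e) = 1 := finrank_span_singleton (norm_ne_zero_iff.1 (by simp [he]))
    rw [finrank_euclideanSpace_fin] at h1
    omega

end Hypersurface

/-! ### The reflection and its Jacobian in the chart. -/

namespace GaussChart

set_option linter.unusedSectionVars false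

variable {n : ℕ} {S : Hypersurface n} {E : Type*} [NormedAddCommGroup E] [InnerProductSpace ℝ E]
  {c : GaussChart E (Euc n)}

theorem inner_pole_dir (z : E) : inner ℝ c.pole (c.dir z) = 1 := by
  rw [dir, inner_add_right, c.inner_pole, real_inner_self_eq_norm_sq, c.norm_pole]
  norm_num

theorem norm_dir_pos (z : E) : 0 < ‖c.dir z‖ := by
  rw [norm_pos_iff]
  intro h
  have := inner_pole_dir (c := c) z
  rw [h, inner_zero_right] at this
  exact zero_ne_one this

variable [FiniteDimensional ℝ E]

variable (c S) in
/-- The parameter of a point of the hypersurface. -/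
def coord (u : Euc n) : E :=
  ContinuousLinearMap.adjoint c.incl.toContinuousLinearMap
    ((inner ℝ c.pole (S.normal u))⁻¹ • S.normal u)

namespace Charts

variable (hc : c.Charts S)
include hc

theorem map_mem {z : E} (hz : z ∈ c.dom) : c.map z ∈ S.carrier :=
  hc.image_map ▸ mem_image_of_mem _ hz

theorem exists_eq_map {u : Euc n} (hu : u ∈ S.carrier) : ∃ z ∈ c.dom, c.map z = u := by
  rw [← hc.image_map] at hu
  exact hu

theorem coord_map {z : E} (hz : z ∈ c.dom) : c.coord S (c.map z) = z := by
  have h1 := (norm_dir_pos (c := c) z).ne'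
  rw [coord, hc.normal_map z hz, inner_smul_right, inner_pole_dir, mul_one, inv_inv, smul_smul,
    mul_inv_cancel₀ h1, one_smul]
  refine ext_inner_left ℝ fun w => ?_
  rw [ContinuousLinearMap.adjoint_inner_right, dir, inner_add_right]
  change inner ℝ (c.incl w) c.pole + inner ℝ (c.incl w) (c.incl z) = _
  rw [real_inner_comm, c.inner_pole, zero_add, LinearIsometry.inner_map_map]

theorem map_coord {u : Euc n} (hu : u ∈ S.carrier) : c.map (c.coord S u) = u := by
  obtain ⟨z, hz, rfl⟩ := hc.exists_eq_map hu
  rw [hc.coord_map hz]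

theorem coord_mem {u : Euc n} (hu : u ∈ S.carrier) : c.coord S u ∈ c.dom := by
  obtain ⟨z, hz, rfl⟩ := hc.exists_eq_map hu
  rwa [hc.coord_map hz]

theorem differentiableWithinAt_coord {u : Euc n} (hu : u ∈ S.carrier) :
    DifferentiableWithinAt ℝ (c.coord S) S.carrier u := by
  have hN := Hypersurface.differentiableWithinAt_normal hu
  have h0 : inner ℝ c.pole (S.normal u) ≠ 0 := by
    obtain ⟨z, hz, rfl⟩ := hc.exists_eq_map hu
    rw [hc.normal_map z hz, inner_smul_right, inner_pole_dir, mul_one]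
    exact inv_ne_zero (norm_dir_pos z).ne'
  have h1 : DifferentiableWithinAt ℝ (fun u => inner ℝ c.pole (S.normal u)) S.carrier u :=
    (differentiableWithinAt_const _).inner ℝ hN
  exact (ContinuousLinearMap.differentiableAt _).comp_differentiableWithinAt u
    ((h1.inv h0).smul hN)

theorem inner_normal_eq_zero_iff {z : E} (hz : z ∈ c.dom) (x : Euc n) :
    inner ℝ x (S.normal (c.map z)) = 0 ↔ inner ℝ x (c.dir z) = 0 := by
  rw [hc.normal_map z hz, inner_smul_right, mul_eq_zero,
    or_iff_right (inv_ne_zero (norm_dir_pos z).ne')]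

/-- Three normals are linearly dependent exactly when their parameters are collinear. With z'' ≠ z'
this puts z on the line through them, and the orthogonality condition then selects `mid`. -/
theorem isReflection_iff {z z' : E} (hz : z ∈ c.dom) (hz' : z' ∈ c.dom) {u : Euc n} :
    S.IsReflection (c.map z) (c.map z') u ↔
      ∃ z'', (z'', z') ∈ c.pairs ∧ c.mid (z'', z') = z ∧ c.map z'' = u := by
  constructor
  · rintro ⟨huS, hne, horth, hdep⟩
    obtain ⟨z'', hz'', rfl⟩ := hc.exists_eq_map huS
    have hp : (z'', z') ∈ c.pairs := ⟨hz'', hz', fun h => hne (by rw [show z'' = z' from h])⟩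
    refine ⟨z'', hp, ?_, rfl⟩
    rw [hc.inner_normal_eq_zero_iff hz] at horth
    obtain ⟨g, hg, i, hgi⟩ := Fintype.not_linearIndependent_iff.1 hdep
    simp only [Fin.sum_univ_three, Matrix.cons_val_zero, Matrix.cons_val_one, Matrix.cons_val,
      hc.normal_map z hz, hc.normal_map z' hz', hc.normal_map z'' hz'', smul_smul] at hg
    set a₀ := g 0 * ‖c.dir z‖⁻¹ with ha₀
    set a₁ := g 1 * ‖c.dir z'‖⁻¹ with ha₁
    set a₂ := g 2 * ‖c.dir z''‖⁻¹ with ha₂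
    -- All directions have component 1 along the pole, so a linear relation among them is an affine
    -- relation among parameters. The coefficient a₀ cannot vanish, since otherwise z'' ≠ z' would
    -- kill the other two.
    have hsum : a₀ + a₁ + a₂ = 0 := by
      have := congrArg (inner ℝ c.pole) hg
      simpa [inner_add_right, inner_smul_right, inner_pole_dir] using this
    have hvec : a₀ • z + a₁ • z' + a₂ • z'' = 0 := by
      apply c.incl.injective
      have : c.incl (a₀ • z + a₁ • z' + a₂ • z'') =
          (a₀ • c.dir z + a₁ • c.dir z' + a₂ • c.dir z'') - (a₀ + a₁ + a₂) • c.pole := by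
        simp only [dir, map_add, map_smul]
        module
      rw [this, hg, hsum, zero_smul, sub_zero, map_zero]
    have hnz : ∀ w : E, ‖c.dir w‖⁻¹ ≠ 0 := fun w => inv_ne_zero (norm_dir_pos w).ne'
    have ha0 : a₀ ≠ 0 := by
      intro h0
      rw [h0, zero_add] at hsum
      rw [h0, zero_smul, zero_add, eq_neg_of_add_eq_zero_right hsum, neg_smul, ← sub_eq_add_neg,
        ← smul_sub, smul_eq_zero, sub_eq_zero] at hvec
      have h1 : a₁ = 0 := hvec.resolve_right (Ne.symm hp.2.2)
      have h2 : a₂ = 0 := by linarith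
      apply hgi
      fin_cases i
      · exact (mul_eq_zero.1 h0).resolve_right (hnz _)
      · exact (mul_eq_zero.1 h1).resolve_right (hnz _)
      · exact (mul_eq_zero.1 h2).resolve_right (hnz _)
    have hzs : z = z' + (-(a₂ / a₀)) • (z'' - z') := by
      apply smul_right_injective E ha0
      change a₀ • z = a₀ • (z' + (-(a₂ / a₀)) • (z'' - z'))
      rw [smul_add, smul_smul, mul_neg, mul_div_cancel₀ _ ha0]
      have h1 : a₀ = -a₁ - a₂ := by linarith
      have h2 : a₀ • z = -(a₁ • z') - a₂ • z'' := by
        rw [add_assoc] at hvec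
        rw [eq_neg_of_add_eq_zero_left hvec]; abel
      rw [h2]
      nth_rw 1 [h1]
      module
    rw [hzs] at horth
    have := (inner_chord_eq_zero_iff hp _).1 horth
    rw [hzs, this]
    rfl
  · rintro ⟨z'', hp, rfl, rfl⟩
    refine ⟨hc.map_mem hp.1, fun h => hp.2.2 (injOn_map hp.1 hp.2.1 h),
      (hc.inner_normal_eq_zero_iff hz _).2 (inner_chord_mid hp), ?_⟩
    rw [Fintype.not_linearIndependent_iff]
    set s := c.weight (z'', z') with hs
    refine ⟨![‖c.dir (c.mid (z'', z'))‖, -(1 - s) * ‖c.dir z'‖, -s * ‖c.dir z''‖], ?_, 0, ?_⟩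
    · simp only [Fin.sum_univ_three, Matrix.cons_val_zero, Matrix.cons_val_one, Matrix.cons_val,
        hc.normal_map _ hz, hc.normal_map z' hp.2.1, hc.normal_map z'' hp.1, smul_smul, mul_assoc,
        mul_inv_cancel₀ (norm_dir_pos _).ne', mul_one, one_smul]
      simp only [dir, mid, map_add, map_smul, map_sub, ← hs]
      module
    · exact (norm_dir_pos _).ne'

/-- `Hypersurface.refl` is defined by choice; `injOn_midPair` says that there is only one candidate.
-/
theorem refl_map {z z' : E} (hq : (z, z') ∈ c.reflDomain) :
    S.refl (c.map z) (c.map z') = c.map (c.reflPair (z, z')).1 := by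
  have hp := reflPair_mem hq
  have h2 := reflPair_snd hq
  have hm := congrArg Prod.fst (midPair_reflPair hq)
  simp only [midPair] at hm h2
  set p := c.reflPair (z, z') with hpdef
  have hz : z ∈ c.dom := hm ▸ mid_mem hp
  have hz' : z' ∈ c.dom := h2 ▸ hp.2.1
  have hpe : (p.1, z') = p := by rw [← h2]
  have hne : c.map z' ≠ c.map z := fun h => by
    have := injOn_map hz' hz h
    rw [← hm, ← h2] at this
    exact mid_ne hp this.symm
  have hex : ∃ u, S.IsReflection (c.map z) (c.map z') u :=
    ⟨_, (hc.isReflection_iff hz hz').2 ⟨p.1, by rwa [hpe], by rw [hpe, hm], rfl⟩⟩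
  have hcond : c.map z' ≠ c.map z ∧ ∃ u, S.IsReflection (c.map z) (c.map z') u := ⟨hne, hex⟩
  rw [Hypersurface.refl, dif_pos hcond]
  obtain ⟨z'', hp', hm', hu'⟩ := (hc.isReflection_iff hz hz').1 hcond.2.choose_spec
  rw [← hu']
  have : (z'', z') = p := injOn_midPair hp' hp (by
    simp only [midPair]
    rw [hm', hm, h2])
  rw [← this]

theorem reflectionDomain_map {z : E} (hz : z ∈ c.dom) {u' : Euc n} :
    u' ∈ S.reflectionDomain (c.map z) ↔ u' ∈ S.carrier ∧ (z, c.coord S u') ∈ c.reflDomain := by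
  refine and_congr_right fun hu' => ?_
  obtain ⟨z', hz', rfl⟩ := hc.exists_eq_map hu'
  rw [hc.coord_map hz']
  constructor
  · rintro ⟨-, u'', hu''⟩
    obtain ⟨z'', hp, hm, -⟩ := (hc.isReflection_iff hz hz').1 hu''
    exact ⟨(z'', z'), hp, by simp only [midPair, hm]⟩
  · rintro ⟨p, hp, hpz⟩
    simp only [midPair, Prod.mk.injEq] at hpz
    obtain ⟨rfl, rfl⟩ := hpz
    exact ⟨fun h => mid_ne hp (injOn_map hp.2.1 hz h).symm, c.map p.1,
      (hc.isReflection_iff hz hz').2 ⟨p.1, hp, rfl, rfl⟩⟩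

theorem finrank_tangentSpace {z : E} (hz : z ∈ c.dom) :
    finrank ℝ E = finrank ℝ (S.tangentSpace (c.map z)) := by
  have h1 := (ℝ ∙ S.normal (c.map z)).finrank_add_finrank_orthogonal
  have h2 : finrank ℝ (ℝ ∙ S.normal (c.map z)) = 1 := finrank_span_singleton
    (norm_ne_zero_iff.1 (by simp [Hypersurface.norm_normal (hc.map_mem hz)]))
  rw [finrank_euclideanSpace_fin, h2] at h1
  rw [hc.finrank_eq]
  change n - 1 = finrank ℝ (ℝ ∙ S.normal (c.map z))ᗮ
  exact (Nat.eq_sub_of_add_eq' h1).symm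

/-- The Jacobian of the reflection, in terms of the density of surface measure in the chart and
the differential of the chord map. -/
theorem jacobian_map {p : E × E} (hp : p ∈ c.pairs) :
    S.jacobian (c.map (c.mid p)) (c.map p.2) *
        (fderiv ℝ c.map (c.mid p)).toLinearMap.normDet * |(fderiv ℝ c.midPair p).det| =
      (fderiv ℝ c.map p.1).toLinearMap.normDet := by
  set z := c.mid p with hz
  have hzd : z ∈ c.dom := mid_mem hp
  have hu := hc.map_mem hzd
  obtain ⟨hev, hD⟩ := eventually_reflPair hp
  rw [show c.midPair p = (z, p.2) from rfl] at hev hD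
  have hpr : c.reflPair (z, p.2) = p := reflPair_midPair hp
  set M : E × E →L[ℝ] E × E := ((midPairDeriv hp).symm : E × E →L[ℝ] E × E) with hM
  set r : E → E := fun w => (c.reflPair (w, p.2)).1 with hr
  set r' : E →L[ℝ] E := (ContinuousLinearMap.fst ℝ E E).comp (M.comp
    (ContinuousLinearMap.inl ℝ E E)) with hr'
  have hrz : r z = p.1 := by simp only [hr]; rw [hpr]
  have hrD : HasFDerivAt r r' z := by
    have h1 : HasFDerivAt (fun w : E => (w, p.2)) (ContinuousLinearMap.inl ℝ E E) z :=
      hasFDerivAt_prodMk_left z p.2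
    exact hasFDerivAt_fst.comp z (hD.hasFDerivAt.comp z h1)
  have hevz : ∀ᶠ w in 𝓝 z, (w, p.2) ∈ c.reflDomain ∧ w ∈ c.dom :=
    ((Continuous.tendsto (f := fun w : E => (w, p.2)) (by fun_prop) z).eventually hev).and
      (c.isOpen_dom.mem_nhds hzd)
  set R : Euc n → Euc n := fun v => S.refl v (c.map p.2) with hR
  -- In the chart the reflection u ↦ R_u u' becomes r, so the chain rule and multiplicativity of
  -- `normDet` compare J with |det r'| and the two densities.
  have hRmap : R ∘ c.map =ᶠ[𝓝 z] c.map ∘ r := by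
    filter_upwards [hevz] with w hw
    exact hc.refl_map hw.1
  have hmr : HasFDerivAt (c.map ∘ r) ((fderiv ℝ c.map p.1).comp r') z := by
    have h1 := hasFDerivAt_map hp.1
    rw [← hrz] at h1
    have := h1.comp z hrD
    rwa [hrz] at this
  have hcoordD := hc.differentiableWithinAt_coord hu
  have hcz : c.coord S (c.map z) = z := hc.coord_map hzd
  -- Differentiability within S, through the factorization by `coord`, ensures that `fderivWithin`
  -- is a genuine derivative and not the default zero.
  have hRD : DifferentiableWithinAt ℝ R S.carrier (c.map z) := by
    have h1 : DifferentiableAt ℝ (c.map ∘ r) (c.coord S (c.map z)) := by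
      rw [hcz]; exact hmr.differentiableAt
    have h2 : DifferentiableWithinAt ℝ ((c.map ∘ r) ∘ c.coord S) S.carrier (c.map z) :=
      h1.comp_differentiableWithinAt _ hcoordD
    have h3 : ∀ᶠ v in 𝓝[S.carrier] c.map z, R v = ((c.map ∘ r) ∘ c.coord S) v := by
      have h4 : Tendsto (c.coord S) (𝓝[S.carrier] c.map z) (𝓝 z) := by
        have := hcoordD.continuousWithinAt
        rwa [ContinuousWithinAt, hcz] at this
      filter_upwards [h4.eventually hRmap, self_mem_nhdsWithin] with v hv hvS
      rw [Function.comp_apply, ← hv, Function.comp_apply, hc.map_coord hvS]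
    exact h2.congr_of_eventuallyEq h3 (h3.self_of_nhdsWithin hu)
  have hchain : HasFDerivAt (R ∘ c.map)
      ((fderivWithin ℝ R S.carrier (c.map z)).comp (fderiv ℝ c.map z)) z :=
    hRD.hasFDerivWithinAt.comp_hasFDerivAt z (hasFDerivAt_map hzd)
      (hevz.mono fun w hw => hc.map_mem hw.2)
  have heq := hchain.unique (hmr.congr_of_eventuallyEq hRmap)
  have htan : ∀ ξ, (fderiv ℝ c.map z).toLinearMap ξ ∈ S.tangentSpace (c.map z) := by
    intro ξ
    rw [Hypersurface.mem_tangentSpace_iff, real_inner_comm, hc.inner_normal_eq_zero_iff hzd]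
    exact c.inner_fderiv z hzd ξ
  have hlin : (S.surfaceDeriv R (c.map z)).toLinearMap ∘ₗ
      (fderiv ℝ c.map z).toLinearMap.codRestrict _ htan =
      (fderiv ℝ c.map p.1).toLinearMap ∘ₗ r'.toLinearMap := by
    ext1 ξ
    exact DFunLike.congr_fun heq ξ
  have hnd := congrArg LinearMap.normDet hlin
  rw [LinearMap.normDet_comp_of_finrank_eq _ _ (hc.finrank_tangentSpace hzd),
    LinearMap.normDet_codRestrict, LinearMap.normDet_comp_of_finrank_eq _ _ rfl,
    LinearMap.normDet_eq_abs_det] at hnd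
  have hMΨ : M.comp (fderiv ℝ c.midPair p) = ContinuousLinearMap.id ℝ (E × E) := by
    rw [(hasStrictFDerivAt_midPair hp).hasFDerivAt.fderiv, hM]
    exact ContinuousLinearMap.ext fun x => (midPairDeriv hp).symm_apply_apply x
  -- The inverse differential M preserves the second coordinate, so it is block triangular and its
  -- determinant is that of its upper left block r'.
  have hMsnd : ∀ q, (M.toLinearMap q).2 = q.2 := by
    intro q
    obtain ⟨x, rfl⟩ := (midPairDeriv hp).surjective q
    have h1 : (midPairDeriv hp x) = fderiv ℝ c.midPair p x := rfl
    have h2 : M.toLinearMap (midPairDeriv hp x) = x := (midPairDeriv hp).symm_apply_apply x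
    rw [h2, h1, fderiv_midPair hp]
  have hdet : |r'.toLinearMap.det| * |(fderiv ℝ c.midPair p).det| = 1 := by
    have h1 : M.toLinearMap.det = r'.toLinearMap.det := det_eq_det_of_snd _ hMsnd
    rw [← h1, ContinuousLinearMap.det, ← abs_mul, ← LinearMap.det_comp]
    have h2 : M.toLinearMap ∘ₗ (fderiv ℝ c.midPair p).toLinearMap = LinearMap.id :=
      congrArg ContinuousLinearMap.toLinearMap hMΨ
    rw [h2, LinearMap.det_id, abs_one]
  rw [Hypersurface.jacobian, hnd, mul_assoc, hdet, mul_one]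

end Charts

end GaussChart

/-! ### Surface measure in the chart and the change of variables on S × S. -/

open Set Filter Topology Module MeasureTheory
open scoped ENNReal

namespace GaussChart

set_option linter.unusedSectionVars false

variable {n : ℕ} {S : Hypersurface n} {E : Type*} [NormedAddCommGroup E] [InnerProductSpace ℝ E]
  {c : GaussChart E (Euc n)} [FiniteDimensional ℝ E] [MeasurableSpace E] [BorelSpace E]

variable (c) in
/-- The density of surface measure in the chart. -/
def density (z : E) : ℝ := (fderiv ℝ c.map z).toLinearMap.normDet

theorem density_pos {z : E} (hz : z ∈ c.dom) : 0 < c.density z :=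
  normDet_pos_of_injective (injective_fderiv_map hz)

theorem continuousOn_fderiv_map : ContinuousOn (fderiv ℝ c.map) c.dom := fun z hz =>
  ((c.contDiffAt z hz).fderiv_right (m := 0) (by simp)).continuousAt.continuousWithinAt

theorem continuousOn_density : ContinuousOn c.density c.dom :=
  continuous_normDet.comp_continuousOn continuousOn_fderiv_map

theorem continuousOn_map : ContinuousOn c.map c.dom := fun _ hz =>
  (hasFDerivAt_map hz).continuousAt.continuousWithinAt

theorem continuousOn_fderiv_midPair : ContinuousOn (fderiv ℝ c.midPair) c.pairs := fun _ hp =>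
  ((contDiffAt_midPair hp).fderiv_right (m := 0) (by simp)).continuousAt.continuousWithinAt

theorem det_fderiv_midPair_ne_zero {p : E × E} (hp : p ∈ c.pairs) :
    (fderiv ℝ c.midPair p).det ≠ 0 := by
  rw [ContinuousLinearMap.det, Ne, LinearMap.det_eq_zero_iff_ker_ne_bot, not_not]
  exact LinearMap.ker_eq_bot.2 (injective_fderiv_midPair hp)

theorem _root_.ContinuousOn.measurable_indicator {α β : Type*} [TopologicalSpace α]
    [MeasurableSpace α] [OpensMeasurableSpace α] [TopologicalSpace β] [MeasurableSpace β]
    [BorelSpace β] [Zero β] {s : Set α} {f : α → β} (hf : ContinuousOn f s)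
    (hs : MeasurableSet s) : Measurable (s.indicator f) := by
  classical
  rw [← piecewise_eq_indicator]
  exact hf.measurable_piecewise continuousOn_const hs

variable (c) in
/-- The Jacobian of the reflection, in parameters. -/
def reflJacobian (q : E × E) : ℝ :=
  c.density (c.reflPair q).1 / (c.density q.1 * |(fderiv ℝ c.midPair (c.reflPair q)).det|)

theorem continuousOn_reflJacobian : ContinuousOn c.reflJacobian c.reflDomain := by
  have h1 : MapsTo c.reflPair c.reflDomain c.pairs := fun q hq => reflPair_mem hq
  have h2 : MapsTo Prod.fst c.reflDomain c.dom := by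
    rintro _ ⟨p, hp, rfl⟩
    exact mid_mem hp
  refine ContinuousOn.div ?_ (ContinuousOn.mul ?_ ?_) fun q hq => ?_
  · exact continuousOn_density.comp (continuous_fst.comp_continuousOn continuousOn_reflPair)
      fun q hq => (h1 hq).1
  · exact continuousOn_density.comp continuousOn_fst h2
  · exact (ContinuousLinearMap.continuous_det.comp_continuousOn
      (continuousOn_fderiv_midPair.comp continuousOn_reflPair h1)).abs
  · exact mul_ne_zero (density_pos (h2 hq)).ne'
      (abs_ne_zero.2 (det_fderiv_midPair_ne_zero (h1 hq)))

/-- The diagonal is a proper linear subspace of E × E once E is nontrivial, hence null. -/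
theorem ae_mem_pairs_iff (hE : 0 < finrank ℝ E) :
    ∀ᵐ q : E × E ∂(volume.prod volume), q ∈ c.pairs ↔ q.1 ∈ c.dom ∧ q.2 ∈ c.dom := by
  have : Nontrivial E := Module.finrank_pos_iff.1 hE
  have h0 : (volume.prod volume : Measure (E × E))
      ((LinearMap.fst ℝ E E - LinearMap.snd ℝ E E).ker : Set (E × E)) = 0 := by
    refine Measure.addHaar_submodule _ _ fun h => ?_
    obtain ⟨x, hx⟩ := exists_ne (0 : E)
    have : (x, (0 : E)) ∈ (LinearMap.fst ℝ E E - LinearMap.snd ℝ E E).ker := h ▸ trivial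
    rw [LinearMap.mem_ker] at this
    exact hx (by simpa using this)
  filter_upwards [measure_eq_zero_iff_ae_notMem.1 h0] with q hq
  have hne : q.1 ≠ q.2 := fun h => hq (by simp [h])
  simp [pairs, hne]

namespace Charts

variable (hc : c.Charts S)
include hc

theorem measurableSet_carrier : MeasurableSet S.carrier := by
  rw [← hc.image_map]
  exact c.isOpen_dom.measurableSet.image_of_continuousOn_injOn continuousOn_map injOn_map

theorem continuousOn_coord : ContinuousOn (c.coord S) S.carrier := fun _ hu =>
  (hc.differentiableWithinAt_coord hu).continuousWithinAt

/-- The area formula, with indicators making the density and the parametrization measurable on all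
of E; the measure only charges the chart domain. -/
theorem surfaceMeasure_eq : S.surfaceMeasure =
    (volume.withDensity (c.dom.indicator fun z => ENNReal.ofReal (c.density z))).map
      (c.dom.indicator c.map) := by
  have h1 := euclideanHausdorffMeasure_restrict_image c.isOpen_dom
    (fun z hz => (c.contDiffAt z hz).hasStrictFDerivAt (by simp)) continuousOn_fderiv_map
    (fun z hz => injective_fderiv_map hz) injOn_map
  rw [hc.image_map, hc.finrank_eq] at h1
  rw [Hypersurface.surfaceMeasure, h1, withDensity_indicator c.isOpen_dom.measurableSet]
  refine Measure.map_congr ?_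
  refine (withDensity_absolutelyContinuous _ _).ae_eq ?_
  filter_upwards [ae_restrict_mem c.isOpen_dom.measurableSet] with z hz
  rw [indicator_of_mem hz]

theorem sFinite_surfaceMeasure : SFinite S.surfaceMeasure := by
  rw [hc.surfaceMeasure_eq]
  infer_instance

theorem surfaceMeasure_lt_top {K : Set (Euc n)} (hK : IsCompact K) (hKS : K ⊆ S.carrier) :
    S.surfaceMeasure K < ⊤ := by
  have hA : IsCompact (c.coord S '' K) := hK.image_of_continuousOn (hc.continuousOn_coord.mono hKS)
  have hAd : c.coord S '' K ⊆ c.dom := by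
    rintro _ ⟨u, hu, rfl⟩
    exact hc.coord_mem (hKS hu)
  have h1 := euclideanHausdorffMeasure_image_eq_lintegral c.isOpen_dom
    (fun z hz => (c.contDiffAt z hz).hasStrictFDerivAt (by simp)) continuousOn_fderiv_map
    (fun z hz => injective_fderiv_map hz) injOn_map hA.measurableSet hAd
  have h2 : c.map '' (c.coord S '' K) = K := by
    rw [image_image]
    refine (image_congr fun u hu => hc.map_coord (hKS hu)).trans (image_id _)
  rw [h2, hc.finrank_eq] at h1
  rw [Hypersurface.surfaceMeasure, Measure.restrict_eq_self _ hKS, h1]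
  exact (((continuousOn_density.mono hAd).integrableOn_compact hA).lintegral_lt_top)

theorem lintegral_prod_surfaceMeasure {f : Euc n × Euc n → ℝ≥0∞} (hf : Measurable f) :
    ∫⁻ p, f p ∂(S.surfaceMeasure.prod S.surfaceMeasure) =
      ∫⁻ q : E × E, (c.dom.indicator (fun z => ENNReal.ofReal (c.density z)) q.1 *
        c.dom.indicator (fun z => ENNReal.ofReal (c.density z)) q.2) *
        f (c.dom.indicator c.map q.1, c.dom.indicator c.map q.2) ∂(volume.prod volume) := by
  have hm : Measurable (c.dom.indicator c.map) :=
    continuousOn_map.measurable_indicator c.isOpen_dom.measurableSet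
  have hd : Measurable (c.dom.indicator fun z => ENNReal.ofReal (c.density z)) :=
    (ENNReal.continuous_ofReal.comp_continuousOn continuousOn_density).measurable_indicator
      c.isOpen_dom.measurableSet
  rw [hc.surfaceMeasure_eq, Measure.map_prod_map _ _ hm hm, prod_withDensity hd hd,
    lintegral_map hf (hm.prodMap hm), lintegral_withDensity_eq_lintegral_mul]
  · rfl
  · exact (hd.comp measurable_fst).mul (hd.comp measurable_snd)
  · exact hf.comp (hm.prodMap hm)

end Charts

variable (c S) in
/-- The set of pairs `(u, u')` for which `R_u u'` exists. -/
def reflSet : Set (Euc n × Euc n) :=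
  {p | (p.1 ∈ S.carrier ∧ p.2 ∈ S.carrier) ∧ (c.coord S p.1, c.coord S p.2) ∈ c.reflDomain}

variable (c S) in
/-- The parameters of a pair of points, as a measurable map. -/
def coordPair (p : Euc n × Euc n) : E × E :=
  (S.carrier.indicator (c.coord S) p.1, S.carrier.indicator (c.coord S) p.2)

variable (c S) in
/-- The map `(u, u') ↦ R_u u'`, as a measurable map. -/
def reflPoint (p : Euc n × Euc n) : Euc n :=
  c.dom.indicator c.map (c.reflDomain.indicator c.reflPair (c.coordPair S p)).1

variable (c S) in
/-- The Jacobian of the reflection, as a measurable function. -/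
def reflFactor (p : Euc n × Euc n) : ℝ :=
  c.reflDomain.indicator c.reflJacobian (c.coordPair S p)

namespace Charts

variable (hc : c.Charts S)
include hc

theorem measurable_coordPair : Measurable (c.coordPair S) := by
  have h := hc.continuousOn_coord.measurable_indicator hc.measurableSet_carrier
  exact (h.comp measurable_fst).prodMk (h.comp measurable_snd)

theorem measurable_reflPoint : Measurable (c.reflPoint S) :=
  (continuousOn_map.measurable_indicator c.isOpen_dom.measurableSet).comp (measurable_fst.comp
    ((continuousOn_reflPair.measurable_indicator isOpen_reflDomain.measurableSet).comp
      hc.measurable_coordPair))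

theorem measurable_reflFactor : Measurable (c.reflFactor S) :=
  (continuousOn_reflJacobian.measurable_indicator isOpen_reflDomain.measurableSet).comp
    hc.measurable_coordPair

theorem coordPair_eq {p : Euc n × Euc n} (hp : p.1 ∈ S.carrier ∧ p.2 ∈ S.carrier) :
    c.coordPair S p = (c.coord S p.1, c.coord S p.2) := by
  rw [coordPair, indicator_of_mem hp.1, indicator_of_mem hp.2]

theorem measurableSet_reflSet : MeasurableSet (c.reflSet S) := by
  have : c.reflSet S = (S.carrier ×ˢ S.carrier) ∩ c.coordPair S ⁻¹' c.reflDomain := by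
    ext p
    refine and_congr_right fun hp => ?_
    rw [mem_preimage, hc.coordPair_eq hp]
  rw [this]
  exact (hc.measurableSet_carrier.prod hc.measurableSet_carrier).inter
    (hc.measurable_coordPair isOpen_reflDomain.measurableSet)

theorem mem_reflectionDomain_iff {u u' : Euc n} (hu : u ∈ S.carrier) :
    u' ∈ S.reflectionDomain u ↔ (u, u') ∈ c.reflSet S := by
  conv_lhs => rw [← hc.map_coord hu]
  rw [hc.reflectionDomain_map (hc.coord_mem hu)]
  exact ⟨fun h => ⟨⟨hu, h.1⟩, h.2⟩, fun h => ⟨h.1.2, h.2⟩⟩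

theorem reflPoint_eq {p : Euc n × Euc n} (hp : p ∈ c.reflSet S) :
    c.reflPoint S p = c.map (c.reflPair (c.coord S p.1, c.coord S p.2)).1 := by
  rw [reflPoint, hc.coordPair_eq hp.1, indicator_of_mem hp.2,
    indicator_of_mem (reflPair_mem hp.2).1]

theorem reflFactor_eq {p : Euc n × Euc n} (hp : p ∈ c.reflSet S) :
    c.reflFactor S p = c.reflJacobian (c.coord S p.1, c.coord S p.2) := by
  rw [reflFactor, hc.coordPair_eq hp.1, indicator_of_mem hp.2]

theorem refl_eq {p : Euc n × Euc n} (hp : p ∈ c.reflSet S) :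
    S.refl p.1 p.2 = c.reflPoint S p := by
  rw [hc.reflPoint_eq hp, ← hc.refl_map hp.2, hc.map_coord hp.1.1, hc.map_coord hp.1.2]

/-- Supplies joint measurability of the Jacobian, which is not visible from its pointwise definition
by `fderivWithin`. -/
theorem jacobian_eq {p : Euc n × Euc n} (hp : p ∈ c.reflSet S) :
    S.jacobian p.1 p.2 = c.reflFactor S p := by
  rw [hc.reflFactor_eq hp]
  obtain ⟨q, hq, hqp⟩ := hp.2
  rw [← hqp, reflJacobian, reflPair_midPair hq]
  simp only [midPair, Prod.mk.injEq] at hqp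
  have h := hc.jacobian_map hq
  rw [hqp.1, hqp.2, hc.map_coord hp.1.1, hc.map_coord hp.1.2] at h
  rw [eq_div_iff, ← mul_assoc]
  · simp only [midPair, hqp.1]
    exact h
  · exact mul_ne_zero (density_pos (mid_mem hq)).ne'
      (abs_ne_zero.2 (det_fderiv_midPair_ne_zero hq))

/-- The reflection carries the product of surface measures, weighted by the Jacobian, to the
product of surface measures. -/
theorem map_reflPoint (hn : 2 ≤ n) :
    (((S.surfaceMeasure.prod S.surfaceMeasure).restrict (c.reflSet S)).withDensity
      fun p => ENNReal.ofReal (c.reflFactor S p)).map (fun p => (c.reflPoint S p, p.2)) =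
      S.surfaceMeasure.prod S.surfaceMeasure := by
  have hT : Measurable fun p : Euc n × Euc n => (c.reflPoint S p, p.2) :=
    hc.measurable_reflPoint.prodMk measurable_snd
  have hJ : Measurable fun p => ENNReal.ofReal (c.reflFactor S p) :=
    hc.measurable_reflFactor.ennreal_ofReal
  ext B hB
  have hBm : Measurable (B.indicator (1 : Euc n × Euc n → ℝ≥0∞)) := measurable_one.indicator hB
  have hTm : Measurable fun p : Euc n × Euc n =>
    B.indicator (1 : Euc n × Euc n → ℝ≥0∞) (c.reflPoint S p, p.2) := hBm.comp hT
  rw [← lintegral_indicator_one hB, ← lintegral_indicator_one hB, lintegral_map hBm hT,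
    lintegral_withDensity_eq_lintegral_mul _ hJ hTm,
    ← lintegral_indicator hc.measurableSet_reflSet, hc.lintegral_prod_surfaceMeasure
      ((hJ.mul hTm).indicator hc.measurableSet_reflSet),
    hc.lintegral_prod_surfaceMeasure hBm]
  set χ : Euc n × Euc n → ℝ≥0∞ := B.indicator 1 with hχ
  set H : E × E → ℝ≥0∞ := fun q => ENNReal.ofReal (c.density q.1) *
    ENNReal.ofReal (c.density q.2) * (ENNReal.ofReal (c.reflJacobian q) *
      χ (c.map (c.reflPair q).1, c.map q.2)) with hH
  -- In parameters the left side lives on the image of the chord map, where the classical change of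
  -- variables applies. The density at the mid and the determinant then cancel against
  -- `reflJacobian`, leaving the product of the densities at the two ends.
  have hl : ∀ q : E × E, (c.dom.indicator (fun z => ENNReal.ofReal (c.density z)) q.1 *
        c.dom.indicator (fun z => ENNReal.ofReal (c.density z)) q.2) *
        (c.reflSet S).indicator ((fun p => ENNReal.ofReal (c.reflFactor S p)) *
          fun p => χ (c.reflPoint S p, p.2))
          (c.dom.indicator c.map q.1, c.dom.indicator c.map q.2) = c.reflDomain.indicator H q := by
    intro q
    by_cases hq : q.1 ∈ c.dom ∧ q.2 ∈ c.dom
    · rw [indicator_of_mem hq.1, indicator_of_mem hq.2, indicator_of_mem hq.1,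
        indicator_of_mem hq.2]
      have hco : (c.coord S (c.map q.1), c.coord S (c.map q.2)) = q := by
        rw [hc.coord_map hq.1, hc.coord_map hq.2]
      by_cases hqr : q ∈ c.reflDomain
      · have hmem : (c.map q.1, c.map q.2) ∈ c.reflSet S :=
          ⟨⟨hc.map_mem hq.1, hc.map_mem hq.2⟩, by rwa [hco]⟩
        rw [indicator_of_mem hmem, indicator_of_mem hqr, hH, Pi.mul_apply,
          hc.reflFactor_eq hmem, hc.reflPoint_eq hmem, hco]
      · have hmem : (c.map q.1, c.map q.2) ∉ c.reflSet S := fun h => hqr (by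
          have := h.2
          rwa [hco] at this)
        rw [indicator_of_notMem hmem, indicator_of_notMem hqr, mul_zero]
    · have hqr : q ∉ c.reflDomain := by
        rintro ⟨p, hp, rfl⟩
        exact hq ⟨mid_mem hp, hp.2.1⟩
      rw [indicator_of_notMem hqr]
      rcases not_and_or.1 hq with h | h <;> rw [indicator_of_notMem h] <;> simp
  simp_rw [hl]
  rw [lintegral_indicator isOpen_reflDomain.measurableSet, reflDomain,
    lintegral_image_eq_lintegral_abs_det_fderiv_mul _ isOpen_pairs.measurableSet
      (fun p hp => ((contDiffAt_midPair hp).differentiableAt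
        (by simp)).hasFDerivAt.hasFDerivWithinAt) injOn_midPair,
    ← lintegral_indicator isOpen_pairs.measurableSet]
  have hE : 0 < finrank ℝ E := by rw [hc.finrank_eq]; omega
  refine lintegral_congr_ae ?_
  filter_upwards [ae_mem_pairs_iff (c := c) hE] with p hp
  by_cases hpp : p ∈ c.pairs
  · obtain ⟨h1, h2⟩ := hp.1 hpp
    rw [indicator_of_mem hpp, indicator_of_mem h1, indicator_of_mem h2, indicator_of_mem h1,
      indicator_of_mem h2, hH]
    simp only [reflPair_midPair hpp, reflJacobian]
    have hm := density_pos (mid_mem hpp)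
    have hd := abs_pos.2 (det_fderiv_midPair_ne_zero hpp)
    have h2' := density_pos h2
    simp only [midPair] at *
    rw [← mul_assoc, ← mul_assoc, ← ENNReal.ofReal_mul hm.le, ← ENNReal.ofReal_mul hd.le,
      ← ENNReal.ofReal_mul (by positivity), ← ENNReal.ofReal_mul (density_pos h1).le]
    congr 2
    field_simp
  · rw [indicator_of_notMem hpp]
    rcases not_and_or.1 (fun h => hpp (hp.2 h)) with h | h <;> rw [indicator_of_notMem h] <;> simp

end Charts

end GaussChart

/-! ### The Wigner kernel on S × S. -/

open Set Filter Topology Module MeasureTheory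
open scoped ENNReal

/-- Change of variables for a measurable map with a Jacobian factor. -/
theorem integrable_and_integral_of_map_withDensity {α β : Type*} [MeasurableSpace α]
    [MeasurableSpace β] {ν : Measure α} {ν' : Measure β} {D : Set α} (hD : MeasurableSet D)
    {J : α → ℝ} (hJ : Measurable J) (hJ0 : ∀ p ∈ D, 0 ≤ J p) {Φ : α → β} (hΦ : Measurable Φ)
    (hmap : ((ν.restrict D).withDensity fun p => ENNReal.ofReal (J p)).map Φ = ν')
    {G : β → ℂ} (hG : Integrable G ν') :
    Integrable (D.indicator fun p => G (Φ p) * (J p : ℂ)) ν ∧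
      ∫ p, D.indicator (fun p => G (Φ p) * (J p : ℂ)) p ∂ν = ∫ q, G q ∂ν' := by
  have h1 : Integrable (fun p => G (Φ p))
      ((ν.restrict D).withDensity fun p => ENNReal.ofReal (J p)) :=
    (hmap ▸ hG).comp_measurable hΦ
  have hlt : ∀ᵐ p ∂(ν.restrict D), ENNReal.ofReal (J p) < ⊤ :=
    Eventually.of_forall fun _ => ENNReal.ofReal_lt_top
  have h2 := (integrable_withDensity_iff_integrable_smul' hJ.ennreal_ofReal hlt).1 h1
  have h3 : (fun p => (ENNReal.ofReal (J p)).toReal • G (Φ p)) =ᵐ[ν.restrict D]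
      fun p => G (Φ p) * (J p : ℂ) := by
    filter_upwards [ae_restrict_mem hD] with p hp
    rw [ENNReal.toReal_ofReal (hJ0 p hp), Complex.real_smul, mul_comm]
  refine ⟨(integrable_indicator_iff hD).2 (h2.congr h3), ?_⟩
  rw [integral_indicator hD, ← integral_congr_ae h3,
    ← integral_withDensity_eq_integral_toReal_smul hJ.ennreal_ofReal hlt]
  subst hmap
  exact (integral_map hΦ.aemeasurable hG.aestronglyMeasurable).symm

/-- Orthogonal coordinates along a unit vector. -/
theorem exists_measurableEquiv_orthogonal {V : Type*} [NormedAddCommGroup V]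
    [InnerProductSpace ℝ V] [FiniteDimensional ℝ V] [MeasurableSpace V] [BorelSpace V] {N : V}
    (hN : ‖N‖ = 1) :
    ∃ e : ((ℝ ∙ N)ᗮ × ℝ) ≃ᵐ V, (∀ p, e p = (p.1 : V) + p.2 • N) ∧
      MeasurePreserving e (volume.prod volume) volume := by
  have h1 := (ℝ ∙ N).measurePreserving_measurableEquivProd (0 : V)
  rw [InnerProductSpace.euclideanHausdorffMeasure_eq_volume] at h1
  set e₁ := (ℝ ∙ N).measurableEquivProd (0 : V) with he₁
  set i : ℝ ≃ₗᵢ[ℝ] (ℝ ∙ N) := LinearIsometryEquiv.toSpanUnitSingleton N hN with hi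
  set e₂ : (ℝ × (ℝ ∙ N)ᗮ) ≃ᵐ ((ℝ ∙ N) × (ℝ ∙ N)ᗮ) :=
    i.toMeasurableEquiv.prodCongr (MeasurableEquiv.refl _) with he₂
  refine ⟨(MeasurableEquiv.prodComm.trans e₂).trans e₁.symm, fun p => ?_, ?_⟩
  · simp only [MeasurableEquiv.trans_apply, he₁, Submodule.measurableEquivProd_symm_apply]
    rw [vadd_eq_add, add_zero, add_comm]
    rfl
  · have h2 : MeasurePreserving e₂ (volume.prod volume) (volume.prod volume) :=
      i.measurePreserving.prod (MeasurePreserving.id _)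
    have h3 : MeasurePreserving (MeasurableEquiv.prodComm : ((ℝ ∙ N)ᗮ × ℝ) ≃ᵐ _)
        (volume.prod volume) (volume.prod volume) := Measure.measurePreserving_swap
    exact (h1.symm).comp (h2.comp h3)

namespace GaussChart

variable {n : ℕ} {S : Hypersurface n} {E : Type*} [NormedAddCommGroup E] [InnerProductSpace ℝ E]
  {c : GaussChart E (Euc n)} [FiniteDimensional ℝ E] [MeasurableSpace E] [BorelSpace E]

/-- The character `exp (-2πi x ⬝ y)`. -/
def character {n : ℕ} (x y : Euc n) : ℂ :=
  Complex.exp (((-2 * Real.pi * inner ℝ x y : ℝ) : ℂ) * Complex.I)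

theorem norm_character (x y : Euc n) : ‖character x y‖ = 1 :=
  Complex.norm_exp_ofReal_mul_I _

theorem continuous_character : Continuous fun p : Euc n × Euc n => character p.1 p.2 := by
  unfold character
  fun_prop

theorem character_sub (x y z : Euc n) :
    character x (y - z) = character x y * conj (character x z) := by
  simp only [character]
  rw [← Complex.exp_conj, ← Complex.exp_add, inner_sub_right]
  congr 1
  simp only [map_mul, Complex.conj_I, Complex.conj_ofReal]
  push_cast
  ring

theorem integrable_mul_character {g : Euc n → ℂ} {μ : Measure (Euc n)} (hg : Integrable g μ)
    (x : Euc n) : Integrable (fun u => g u * character x u) μ :=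
  hg.mul_bdd ((continuous_character.comp (by fun_prop :
    Continuous fun u : Euc n => (x, u))).aestronglyMeasurable)
    (Eventually.of_forall fun u => (norm_character x u).le)

set_option linter.unusedSectionVars false

variable (c S) in
/-- The integrand of the Wigner transform as a function of `(u, u')`. -/
def wignerKernel (g : Euc n → ℂ) (x : Euc n) (p : Euc n × Euc n) : ℂ :=
  (c.reflSet S).indicator (fun p => (g p.2 * conj (g (c.reflPoint S p)) *
    character x (p.2 - c.reflPoint S p)) * (c.reflFactor S p : ℂ)) p

variable (c S) in
/-- The Wigner transform, with its second variable in the ambient space. -/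
def ambientWigner (g : Euc n → ℂ) (x u : Euc n) : ℂ :=
  ∫ u', c.wignerKernel S g x (u, u') ∂S.surfaceMeasure

/-- The dependence on x is a unimodular factor, so integrability at x = 0 gives integrability at all
x, with an exceptional null set of u independent of x. -/
theorem wignerKernel_eq (g : Euc n → ℂ) (x : Euc n) (p : Euc n × Euc n) :
    c.wignerKernel S g x p = c.wignerKernel S g 0 p * character x (p.2 - c.reflPoint S p) := by
  by_cases hp : p ∈ c.reflSet S
  · rw [wignerKernel, wignerKernel, indicator_of_mem hp, indicator_of_mem hp]
    have : character 0 (p.2 - c.reflPoint S p) = 1 := by simp [character]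
    rw [this]
    ring
  · rw [wignerKernel, wignerKernel, indicator_of_notMem hp, indicator_of_notMem hp, zero_mul]

namespace Charts

variable (hc : c.Charts S)
include hc

/-- The kernel is the pullback, times the Jacobian, of conj(gx(u'')) gx(u') along (u, u') ↦ (R_u u',
u'), where gx is g times the character of x. By `map_reflPoint` its integral is that of the tensor
product, which is the squared modulus. -/
theorem integrable_wignerKernel (hn : 2 ≤ n) {g : Euc n → ℂ} (hg : Integrable g S.surfaceMeasure)
    (x : Euc n) :
    Integrable (c.wignerKernel S g x) (S.surfaceMeasure.prod S.surfaceMeasure) ∧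
      ∫ p, c.wignerKernel S g x p ∂(S.surfaceMeasure.prod S.surfaceMeasure) =
        ((‖S.extension g x‖ ^ 2 : ℝ) : ℂ) := by
  have := hc.sFinite_surfaceMeasure
  set gx : Euc n → ℂ := fun u => g u * character x u with hgx
  have hgxi : Integrable gx S.surfaceMeasure := integrable_mul_character hg x
  have hgxc : Integrable (fun u => conj (gx u)) S.surfaceMeasure := by
    exact Complex.conjLIE.toContinuousLinearEquiv.toContinuousLinearMap.integrable_comp hgxi
  set G : Euc n × Euc n → ℂ := fun p => conj (gx p.1) * gx p.2 with hG
  have hGi : Integrable G (S.surfaceMeasure.prod S.surfaceMeasure) := hgxc.mul_prod hgxi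
  have h := integrable_and_integral_of_map_withDensity hc.measurableSet_reflSet
    hc.measurable_reflFactor (fun p hp => by
      rw [← hc.jacobian_eq hp]; exact LinearMap.normDet_nonneg _)
    (hc.measurable_reflPoint.prodMk measurable_snd) (hc.map_reflPoint hn) hGi
  have hk : c.wignerKernel S g x = (c.reflSet S).indicator
      (fun p => G (c.reflPoint S p, p.2) * (c.reflFactor S p : ℂ)) := by
    ext p
    rw [wignerKernel]
    congr 1
    ext p
    simp only [hG, hgx, character_sub, map_mul]
    ring
  rw [← hk] at h
  refine ⟨h.1, h.2.trans ?_⟩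
  rw [integral_prod_mul (fun u => conj (gx u)) gx, integral_conj]
  have he : S.extension g x = ∫ u, gx u ∂S.surfaceMeasure := rfl
  rw [← he, Complex.conj_mul']
  push_cast
  rfl

theorem ae_integrable_wignerKernel (hn : 2 ≤ n) {g : Euc n → ℂ}
    (hg : Integrable g S.surfaceMeasure) :
    ∀ᵐ u ∂S.surfaceMeasure, ∀ x,
      Integrable (fun u' => c.wignerKernel S g x (u, u')) S.surfaceMeasure := by
  have := hc.sFinite_surfaceMeasure
  filter_upwards [(hc.integrable_wignerKernel hn hg 0).1.prod_right_ae] with u hu x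
  simp_rw [wignerKernel_eq g x]
  refine hu.mul_bdd ?_ (Eventually.of_forall fun u' => (norm_character _ _).le)
  have hm : Measurable fun u' => (x, u' - c.reflPoint S (u, u')) :=
    measurable_const.prodMk (measurable_id.sub
      (hc.measurable_reflPoint.comp measurable_prodMk_left))
  exact (continuous_character.measurable.comp hm).aestronglyMeasurable

theorem wignerIntegrand_eq {g : Euc n → ℂ} {u u' : Euc n} (h : (u, u') ∈ c.reflSet S)
    (v : S.tangentSpace u) : S.wignerIntegrand g g u v u' = c.wignerKernel S g v (u, u') := by
  rw [wignerKernel, indicator_of_mem h, Hypersurface.wignerIntegrand, ← hc.refl_eq h,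
    ← hc.jacobian_eq h]
  rfl

theorem reflectionDomain_eq {u : Euc n} (hu : u ∈ S.carrier) :
    S.reflectionDomain u = Prod.mk u ⁻¹' c.reflSet S :=
  Set.ext fun _ => hc.mem_reflectionDomain_iff hu

theorem measurableSet_reflectionDomain {u : Euc n} (hu : u ∈ S.carrier) :
    MeasurableSet (S.reflectionDomain u) := by
  rw [hc.reflectionDomain_eq hu]
  exact measurable_prodMk_left hc.measurableSet_reflSet

theorem indicator_wignerIntegrand {g : Euc n → ℂ} {u : Euc n} (hu : u ∈ S.carrier)
    (v : S.tangentSpace u) :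
    (S.reflectionDomain u).indicator (S.wignerIntegrand g g u v) =
      fun u' => c.wignerKernel S g v (u, u') := by
  ext u'
  by_cases h : (u, u') ∈ c.reflSet S
  · rw [indicator_of_mem ((hc.mem_reflectionDomain_iff hu).2 h), hc.wignerIntegrand_eq h]
  · rw [indicator_of_notMem (fun h' => h ((hc.mem_reflectionDomain_iff hu).1 h')), wignerKernel,
      indicator_of_notMem h]

theorem wigner_eq {g : Euc n → ℂ} {u : Euc n} (hu : u ∈ S.carrier) (v : S.tangentSpace u) :
    S.wigner g g u v = c.ambientWigner S g v u := by
  rw [Hypersurface.wigner, ← integral_indicator (hc.measurableSet_reflectionDomain hu),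
    hc.indicator_wignerIntegrand hu, ambientWigner]

theorem inner_normal_sub_reflPoint {p : Euc n × Euc n} (hp : p ∈ c.reflSet S) :
    inner ℝ (S.normal p.1) (p.2 - c.reflPoint S p) = 0 := by
  have h2 := reflPair_mem hp.2
  have h3 := congrArg Prod.fst (midPair_reflPair hp.2)
  have h4 := inner_chord_mid h2
  rw [reflPair_snd hp.2] at h4
  simp only [midPair] at h3
  rw [h3, ← hc.inner_normal_eq_zero_iff (hc.coord_mem hp.1.1), hc.map_coord hp.1.1,
    hc.map_coord hp.1.2, ← hc.reflPoint_eq hp] at h4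
  rw [real_inner_comm]
  exact h4

/-- The chord from R_u u' to u' is orthogonal to N(u), so the phase ignores the normal component of
x. -/
theorem ambientWigner_add_smul {g : Euc n → ℂ} (u x : Euc n) (t : ℝ) :
    c.ambientWigner S g (x + t • S.normal u) u = c.ambientWigner S g x u := by
  refine integral_congr_ae (Eventually.of_forall fun u' => ?_)
  by_cases h : (u, u') ∈ c.reflSet S
  · have h1 := hc.inner_normal_sub_reflPoint h
    simp only [wignerKernel, indicator_of_mem h, character, inner_add_left, inner_smul_left, h1,
      mul_zero, add_zero]
  · simp only [wignerKernel, indicator_of_notMem h]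

theorem ambientWigner_projection {g : Euc n → ℂ} (u x : Euc n) :
    c.ambientWigner S g ((S.tangentSpace u).orthogonalProjectionOnto x : Euc n) u =
      c.ambientWigner S g x u := by
  have h1 : x - ((S.tangentSpace u).orthogonalProjectionOnto x : Euc n) ∈ ℝ ∙ S.normal u := by
    have := (S.tangentSpace u).sub_starProjection_mem_orthogonal x
    rwa [Submodule.orthogonal_orthogonal] at this
  obtain ⟨t, ht⟩ := Submodule.mem_span_singleton.1 h1
  rw [← hc.ambientWigner_add_smul u _ t, ht, add_sub_cancel]

end Charts

end GaussChart

/-- Compact subsets of S have finite surface measure, so L² is contained in L¹ there. Only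
integrability of g matters from here on. -/
theorem Hypersurface.integrable_of_compact_support {n : ℕ} {S : Hypersurface n}
    {E : Type*} [NormedAddCommGroup E] [InnerProductSpace ℝ E] {c : GaussChart E (Euc n)}
    [FiniteDimensional ℝ E] [MeasurableSpace E] [BorelSpace E] (hc : c.Charts S)
    {g : Euc n → ℂ} (hg : MemLp g 2 S.surfaceMeasure) {K : Set (Euc n)} (hK : IsCompact K)
    (hKS : K ⊆ S.carrier) (hgK : ∀ᵐ u ∂S.surfaceMeasure, u ∉ K → g u = 0) :
    Integrable g S.surfaceMeasure := by
  have : IsFiniteMeasure (S.surfaceMeasure.restrict K) :=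
    ⟨by rw [Measure.restrict_apply_univ]; exact hc.surfaceMeasure_lt_top hK hKS⟩
  have h1 : IntegrableOn g K S.surfaceMeasure :=
    memLp_one_iff_integrable.1 ((hg.restrict K).mono_exponent (by norm_num))
  exact h1.integrable_of_ae_notMem_eq_zero hgK

/-! ### Fubini and duality with the X-ray transform. -/

namespace GaussChart.Charts

variable {n : ℕ} {S : Hypersurface n} {E : Type*} [NormedAddCommGroup E] [InnerProductSpace ℝ E]
  {c : GaussChart E (Euc n)} [FiniteDimensional ℝ E] [MeasurableSpace E] [BorelSpace E]

theorem ae_mem_carrier (hc : c.Charts S) : ∀ᵐ u ∂S.surfaceMeasure, u ∈ S.carrier :=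
  ae_restrict_mem hc.measurableSet_carrier

/-- On ℝⁿ × S × S the integrand is the tensor product of w and the kernel at 0, up to a unimodular
factor. Integrating out u' gives the claim and permits every later exchange of integrals. -/
theorem integrable_ambientWigner_mul (hc : c.Charts S) (hn : 2 ≤ n) {g : Euc n → ℂ}
    (hg : Integrable g S.surfaceMeasure) {w : Euc n → ℂ} (hw : Integrable w) :
    Integrable (fun p : Euc n × Euc n => c.ambientWigner S g p.1 p.2 * w p.1)
      ((volume : Measure (Euc n)).prod S.surfaceMeasure) := by
  have := hc.sFinite_surfaceMeasure
  set σ := S.surfaceMeasure with hσ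
  have h1 : Integrable (fun q : Euc n × (Euc n × Euc n) => w q.1 * c.wignerKernel S g 0 q.2)
      ((volume : Measure (Euc n)).prod (σ.prod σ)) :=
    hw.mul_prod (hc.integrable_wignerKernel hn hg 0).1
  have hm : Measurable fun q : Euc n × (Euc n × Euc n) =>
      (q.1, q.2.2 - c.reflPoint S q.2) :=
    measurable_fst.prodMk ((measurable_snd.comp measurable_snd).sub
      (hc.measurable_reflPoint.comp measurable_snd))
  have h2 := h1.mul_bdd (continuous_character.measurable.comp hm).aestronglyMeasurable
    (Eventually.of_forall fun q => (norm_character _ _).le)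
  have h3 := ((measurePreserving_prodAssoc (volume : Measure (Euc n)) σ σ).integrable_comp_emb
    MeasurableEquiv.prodAssoc.measurableEmbedding).2 h2
  refine h3.integral_prod_left.congr (Eventually.of_forall fun p => ?_)
  simp only [ambientWigner]
  rw [← integral_mul_const]
  refine integral_congr_ae (Eventually.of_forall fun u' => ?_)
  simp only [Function.comp_apply, MeasurableEquiv.prodAssoc, MeasurableEquiv.coe_mk,
    Equiv.prodAssoc_apply]
  rw [wignerKernel_eq g p.1]
  ring

theorem ambientWigner_integrable (hc : c.Charts S) (hn : 2 ≤ n) {g : Euc n → ℂ}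
    (hg : Integrable g S.surfaceMeasure) (x : Euc n) :
    Integrable (fun u => c.ambientWigner S g x u) S.surfaceMeasure ∧
      ∫ u, c.ambientWigner S g x u ∂S.surfaceMeasure = ((‖S.extension g x‖ ^ 2 : ℝ) : ℂ) := by
  have := hc.sFinite_surfaceMeasure
  have h := hc.integrable_wignerKernel hn hg x
  exact ⟨h.1.integral_prod_left, by rw [← h.2, integral_prod _ h.1]; rfl⟩

/-- Write x = v + tN(u) with v tangent. The Wigner factor does not depend on t, so the t-integral
falls on w alone and produces its X-ray transform. -/
theorem fiber_integral (hc : c.Charts S) {g w : Euc n → ℂ} {u : Euc n} (hu : u ∈ S.carrier)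
    (h : Integrable fun x => c.ambientWigner S g x u * w x) :
    Integrable (fun v : S.tangentSpace u => S.wigner g g u v * S.surfaceXray w u v) ∧
      ∫ v : S.tangentSpace u, S.wigner g g u v * S.surfaceXray w u v =
        ∫ x, c.ambientWigner S g x u * w x := by
  obtain ⟨e, he, hem⟩ := exists_measurableEquiv_orthogonal (Hypersurface.norm_normal hu)
  have h1 := (hem.integrable_comp_emb e.measurableEmbedding).2 h
  have h2 := hem.integral_comp e.measurableEmbedding fun x => c.ambientWigner S g x u * w x
  have h3 : ∀ v : S.tangentSpace u, ∫ t : ℝ, (c.ambientWigner S g (e (v, t)) u * w (e (v, t))) =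
      S.wigner g g u v * S.surfaceXray w u v := by
    intro v
    rw [hc.wigner_eq hu, Hypersurface.surfaceXray, xray, ← integral_const_mul]
    refine integral_congr_ae (Eventually.of_forall fun t => ?_)
    simp only [he, hc.ambientWigner_add_smul]
  constructor
  · exact h1.integral_prod_left.congr (Eventually.of_forall h3)
  · rw [← h2]
    refine Eq.trans ?_ (integral_prod _ h1).symm
    exact integral_congr_ae (Eventually.of_forall fun v => (h3 v).symm)

end GaussChart.Charts

end PhaseSpace
end

theorem proposition4p3 (n : ℕ) (hn : 2 ≤ n) (S : PhaseSpace.Hypersurface n)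
    (hconv : S.StrictlyConvex) (hgeo : S.GeodesicallyConvexNormals)
    (g : PhaseSpace.Euc n → ℂ) (hg : MeasureTheory.MemLp g 2 S.surfaceMeasure)
    (hsupp : ∃ K : Set (PhaseSpace.Euc n), IsCompact K ∧ K ⊆ S.carrier ∧
      ∀ᵐ u ∂S.surfaceMeasure, u ∉ K → g u = 0) :
    -- the Wigner distribution is given by an absolutely convergent integral
    (∀ᵐ u ∂S.surfaceMeasure, ∀ v : S.tangentSpace u,
      MeasureTheory.IntegrableOn (S.wignerIntegrand g g u v) (S.reflectionDomain u)
        S.surfaceMeasure) ∧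
    -- the phase-space representation, pointwise
    (∀ x : PhaseSpace.Euc n,
      MeasureTheory.Integrable
        (fun u => S.wigner g g u ((S.tangentSpace u).orthogonalProjectionOnto x)) S.surfaceMeasure ∧
      ((‖S.extension g x‖ ^ 2 : ℝ) : ℂ) = S.surfaceXrayAdjoint (S.wigner g g) x) ∧
    -- the phase-space representation, in dual form
    (∀ w : PhaseSpace.Euc n → ℂ, MeasureTheory.Integrable w →
      MeasureTheory.Integrable (fun x => ((‖S.extension g x‖ ^ 2 : ℝ) : ℂ) * w x) ∧
      (∀ᵐ u ∂S.surfaceMeasure, MeasureTheory.Integrable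
        (fun v : S.tangentSpace u => S.wigner g g u v * S.surfaceXray w u v)) ∧
      MeasureTheory.Integrable
        (fun u => ∫ v : S.tangentSpace u, S.wigner g g u v * S.surfaceXray w u v)
        S.surfaceMeasure ∧
      ∫ x, ((‖S.extension g x‖ ^ 2 : ℝ) : ℂ) * w x =
        ∫ u, (∫ v : S.tangentSpace u, S.wigner g g u v * S.surfaceXray w u v)
          ∂S.surfaceMeasure) := by
  obtain ⟨K, hK, hKS, hgK⟩ := hsupp
  obtain ⟨e, he, hpos⟩ := PhaseSpace.Hypersurface.exists_pole hn hconv hgeo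
  have hc := PhaseSpace.Hypersurface.charts_gaussChart hconv hgeo he hpos
  set c := PhaseSpace.Hypersurface.gaussChart hconv hgeo he
  have hgi := PhaseSpace.Hypersurface.integrable_of_compact_support hc hg hK hKS hgK
  have := hc.sFinite_surfaceMeasure
  refine ⟨?_, fun x => ?_, fun w hw => ?_⟩
  · filter_upwards [hc.ae_integrable_wignerKernel hn hgi, hc.ae_mem_carrier] with u hu huS v
    rw [← MeasureTheory.integrable_indicator_iff (hc.measurableSet_reflectionDomain huS),
      hc.indicator_wignerIntegrand huS]
    exact hu v
  · obtain ⟨h1, h2⟩ := hc.ambientWigner_integrable hn hgi x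
    have h3 : (fun u => c.ambientWigner S g x u) =ᵐ[S.surfaceMeasure]
        fun u => S.wigner g g u ((S.tangentSpace u).orthogonalProjectionOnto x) := by
      filter_upwards [hc.ae_mem_carrier] with u hu
      rw [hc.wigner_eq hu, hc.ambientWigner_projection]
    exact ⟨h1.congr h3, h2.symm.trans (MeasureTheory.integral_congr_ae h3)⟩
  · have hQ := hc.integrable_ambientWigner_mul hn hgi hw
    have hx : ∀ x, ∫ u, c.ambientWigner S g x u * w x ∂S.surfaceMeasure =
        ((‖S.extension g x‖ ^ 2 : ℝ) : ℂ) * w x := fun x => by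
      rw [MeasureTheory.integral_mul_const, (hc.ambientWigner_integrable hn hgi x).2]
    -- Both iterated integrals of the same function on ℝⁿ × S are used: integrating over u first
    -- gives the left side, over x first the right side.
    have hfib := hc.ae_mem_carrier.and hQ.prod_left_ae
    have hI : (fun u => ∫ x, c.ambientWigner S g x u * w x) =ᵐ[S.surfaceMeasure]
        fun u => ∫ v : S.tangentSpace u, S.wigner g g u v * S.surfaceXray w u v :=
      hfib.mono fun u hu => (hc.fiber_integral hu.1 hu.2).2.symm
    refine ⟨hQ.integral_prod_left.congr (Filter.Eventually.of_forall hx),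
      hfib.mono fun u hu => (hc.fiber_integral hu.1 hu.2).1,
      hQ.integral_prod_right.congr hI, ?_⟩
    rw [← MeasureTheory.integral_congr_ae hI, ← MeasureTheory.integral_integral_swap hQ]
    exact MeasureTheory.integral_congr_ae (Filter.Eventually.of_forall fun x => (hx x).symm)
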